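/- Let $\beta>0$, let $\mathcal H$ be a $d$-dimensional Hilbert space with Hamiltonian $H=\sum_{i=1}^d E_i|i\rangle\langle i|$, and let $\tau=e^{-\beta H}/\operatorname{Tr}e^{-\beta H}$. Assume that $H$ is not a multiple of the identity (or that $d=1$). Write $\mathcal D(\cdot)$ for the set of density operators on a Hilbert space. On $\mathcal H^{\otimes n}$ the Hamiltonian is $H^{\times n}=\sum_{j=1}^n I^{\otimes(j-1)}\otimes H\otimes I^{\otimes(n-j)}$. The work storage is the Hilbert space $\mathcal H_W$ with orthonormal basis $\{|W\rangle: W\in\mathbb W\}$ and Hamiltonian $H_W=\sum_{W\in\mathbb W}W|W\rangle\langle W|$, where $$\mathbb W=\Big\{\sum_{i=1}^d N_iE_i\ge 0 \;:\; N_i\in\mathbb Z,\ \sum_{i=1}^d N_i=0\Big\}.$$ A map $\Lambda:\mathcal D(\mathcal H_A)\to\mathcal D(\mathcal H_B)$ is a thermal operation if there are a bath $E$ with Hamiltonian $H_E$, $\operatorname{Tr}e^{-\beta H_E}<\infty$, and Gibbs state $\tau_E=e^{-\beta H_E}/\operatorname{Tr}e^{-\beta H_E}$, a decomposition of the composite system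 $A+E$ into $B$ and a remainder (with additive Hamiltonians), and a unitary $U$ on $A+E$ with $[U,H_A\otimes I+I\otimes H_E]=0$, such that $\Lambda(\rho)=\operatorname{Tr}_{A+E-B}[U(\rho\otimes\tau_E)U^\dagger]$ for all $\rho\in\mathcal D(\mathcal H_A)$. For a thermal operation $\Lambda:\mathcal D(\mathcal H^{\otimes n}\otimes\mathcal H_W)\to\mathcal D(\mathcal H_W)$, a state $\rho\in\mathcal D(\mathcal H)$ and $\varepsilon>0$, put $$W^\varepsilon(\rho^{\otimes n},\Lambda)=\max\big\{W\in\mathbb W : \langle W|\,\Lambda(\rho^{\otimes n}\otimes|0\rangle\langle 0|)\,|W\rangle\ge 1-\varepsilon\big\}$$ (and $-\infty$ if there is no such $W$). Then there is a single sequence of thermal operations $\Lambda_n:\mathcal D(\mathcal H^{\otimes n}\otimes\mathcal H_W)\to\mathcal D(\mathcal H_W)$, $n\in\mathbb N$, not depending on $\rho$, such that for every state $\rho\in\mathcal D(\mathcal H)$ $$\beta\,\lim_{\varepsilon\to+0}\ \limsup_{n\to\infty}\ \frac1n\,W^\varepsilon(\rho^{\otimes n},\Lambda_n)=D(\rho\|\tau),\qquad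 D(\rho\|\tau)=\operatorname{Tr}[\rho\log\rho-\rho\log\tau].$$ -/

import Mathlib

/-!
Quantum systems are described in an orthonormal basis of energy eigenvectors.  A system is an index
type `ι` (labelling the eigenvectors `|i⟩`) together with its energy levels `E : ι → ℝ`; its Hilbert
space is `ℓ²(ι)` and its Hamiltonian is `H = ∑ i, E i |i⟩⟨i|`.  Operators are given by their matrix
elements `⟨i|X|j⟩`; nothing forces a state to be diagonal.  The index type may be infinite: sums over
an infinite index type below converge absolutely for the density matrices and unitaries to which they
are applied.
-/

open Filter Topology
open scoped Kronecker ComplexOrder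

noncomputable section

namespace Thermo

/-- Density operators on `ℓ²(ι)`, by their matrix elements: positive semidefinite, of trace one. -/
def IsDensity {ι : Type*} (ρ : Matrix ι ι ℂ) : Prop :=
  ρ.PosSemidef ∧ HasSum (fun i => ρ i i) 1

/-- Unitary operators on `ℓ²(ι)`, by their matrix elements: `U† U = 1` and `U U† = 1`. -/
def IsUnitary {ι : Type*} (U : Matrix ι ι ℂ) : Prop :=
  (∀ i, HasSum (fun k => star (U k i) * U k i) 1) ∧
  (∀ i j, i ≠ j → HasSum (fun k => star (U k i) * U k j) 0) ∧
  (∀ i, HasSum (fun k => U i k * star (U i k)) 1) ∧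
  (∀ i j, i ≠ j → HasSum (fun k => U i k * star (U j k)) 0)

/-- The matrix of `U X U†`. -/
def conjBy {ι : Type*} (U X : Matrix ι ι ℂ) : Matrix ι ι ℂ :=
  fun i j => ∑' p : ι × ι, U i p.1 * X p.1 p.2 * star (U j p.2)

/-- `[U, H] = 0` for `H = ∑ i, E i |i⟩⟨i|`, read as `⟨i|H U|j⟩ = ⟨i|U H|j⟩`. -/
def ConservesEnergy {ι : Type*} (E : ι → ℝ) (U : Matrix ι ι ℂ) : Prop :=
  ∀ i j, (E i : ℂ) * U i j = U i j * (E j : ℂ)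

/-- The partial trace over the second factor. -/
def partialTrace {b f : Type*} (X : Matrix (b × f) (b × f) ℂ) : Matrix b b ℂ :=
  fun i j => ∑' k : f, X (i, k) (j, k)

/-- Energy levels of two systems without interaction: `H_A ⊗ I + I ⊗ H_B`. -/
def addEnergy {a b : Type*} (EA : a → ℝ) (EB : b → ℝ) : a × b → ℝ :=
  fun p => EA p.1 + EB p.2

/-- The partition function `Tr e^{-βH}`. -/
def partitionFn {ι : Type*} (β : ℝ) (E : ι → ℝ) : ℝ :=
  ∑' i, Real.exp (-β * E i)

open Classical in
/-- The Gibbs state `e^{-βH} / Tr e^{-βH}`. -/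
def gibbs {ι : Type*} (β : ℝ) (E : ι → ℝ) : Matrix ι ι ℂ :=
  Matrix.diagonal fun i => ((Real.exp (-β * E i) / partitionFn β E : ℝ) : ℂ)

/-- `Λ` is a thermal operation from the system `(a, EA)` to the system `(b, EB)` at inverse
temperature `β`: there are a bath `(κ, EK)` with finite partition function, a decomposition of the
noninteracting composite of input and bath into the output system and a remainder `(r, ER)`, and a
unitary `U` of this composite commuting with its total Hamiltonian, such that on every state `ρ`,
`Λ ρ` is obtained by attaching the Gibbs state of the bath, applying `U`, and tracing out the
remainder. -/
def IsThermalOperation {a b : Type} (β : ℝ) (EA : a → ℝ) (EB : b → ℝ)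
    (Λ : Matrix a a ℂ → Matrix b b ℂ) : Prop :=
  ∃ (κ r : Type) (EK : κ → ℝ) (ER : r → ℝ) (e : a × κ ≃ b × r)
    (U : Matrix (a × κ) (a × κ) ℂ),
    Summable (fun k => Real.exp (-β * EK k)) ∧
    (∀ x, addEnergy EB ER (e x) = addEnergy EA EK x) ∧
    IsUnitary U ∧
    ConservesEnergy (addEnergy EA EK) U ∧
    ∀ ρ : Matrix a a ℂ, IsDensity ρ →
      Λ ρ = partialTrace ((conjBy U (ρ ⊗ₖ gibbs β EK)).submatrix e.symm e.symm)

/-- Energy levels of `n` noninteracting copies of a system. -/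
def copiesEnergy {ι : Type*} (E : ι → ℝ) (n : ℕ) : (Fin n → ι) → ℝ :=
  fun s => ∑ i, E (s i)

/-- The matrix of `ρ^{⊗ n}`. -/
def tensorPower {ι : Type*} (ρ : Matrix ι ι ℂ) (n : ℕ) : Matrix (Fin n → ι) (Fin n → ι) ℂ :=
  fun s t => ∏ i, ρ (s i) (t i)

/-- The energy levels of the work storage: all `∑ i, N i * E i ≥ 0` with `N i ∈ ℤ`, `∑ i, N i = 0`. -/
def workSet {d : ℕ} (E : Fin d → ℝ) : Set ℝ :=
  {W | 0 ≤ W ∧ ∃ N : Fin d → ℤ, ∑ i, N i = 0 ∧ W = ∑ i, (N i : ℝ) * E i}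

/-- Energy levels of the work storage, whose Hamiltonian is `∑ W ∈ workSet E, W |W⟩⟨W|`. -/
def workEnergy {d : ℕ} (E : Fin d → ℝ) : workSet E → ℝ := fun W => W

/-- The label of the ground state `|0⟩` of the work storage. -/
def workGround {d : ℕ} (E : Fin d → ℝ) : workSet E := ⟨0, le_refl 0, 0, by simp, by simp⟩

open Classical in
/-- The projector `|i⟩⟨i|`. -/
def basisProj {ι : Type*} (i : ι) : Matrix ι ι ℂ := Matrix.single i i 1

/-- The fidelity `F(σ, |i⟩⟨i|) = ⟨i|σ|i⟩` of a state `σ` with the pure state `|i⟩⟨i|`. -/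
def fidelityBasis {ι : Type*} (σ : Matrix ι ι ℂ) (i : ι) : ℝ := (σ i i).re

/-- The work `max {W ∈ workSet E | F(Λ(ρ^{⊗ n} ⊗ |0⟩⟨0|), |W⟩⟨W|) ≥ 1 - ε}` extracted by `Λ` from
`ρ^{⊗ n}` with error `ε`, with value `-∞` if there is no such `W`.  For `ε < 1` the set is finite,
because the fidelities of a state with the various `|W⟩⟨W|` add up to one. -/
def extractedWork {d : ℕ} (E : Fin d → ℝ) (n : ℕ)
    (Λ : Matrix ((Fin n → Fin d) × workSet E) ((Fin n → Fin d) × workSet E) ℂ →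
      Matrix (workSet E) (workSet E) ℂ)
    (ρ : Matrix (Fin d) (Fin d) ℂ) (ε : ℝ) : EReal :=
  sSup {x : EReal | ∃ W : workSet E, x = ((W : ℝ) : EReal) ∧
    1 - ε ≤ fidelityBasis (Λ (tensorPower ρ n ⊗ₖ basisProj (workGround E))) W}

/-- `lim_{ε → +0} limsup_{n → ∞} W^ε(ρ^{⊗ n}, Λ_n) / n = R`. -/
def HasWorkRate {d : ℕ} (E : Fin d → ℝ)
    (Λ : ∀ n : ℕ, Matrix ((Fin n → Fin d) × workSet E) ((Fin n → Fin d) × workSet E) ℂ →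
      Matrix (workSet E) (workSet E) ℂ)
    (ρ : Matrix (Fin d) (Fin d) ℂ) (R : ℝ) : Prop :=
  Tendsto (fun ε : ℝ => limsup (fun n : ℕ => extractedWork E n (Λ n) ρ ε / (n : EReal)) atTop)
    (𝓝[>] 0) (𝓝 (R : EReal))

/-- `R` is an `S`-achievable state-agnostic work extraction rate: one sequence of thermal operations
attains the rate `R ρ` for every `ρ ∈ S`. -/
def IsAchievableAgnosticRate {d : ℕ} (β : ℝ) (E : Fin d → ℝ)
    (S : Set (Matrix (Fin d) (Fin d) ℂ)) (R : Matrix (Fin d) (Fin d) ℂ → ℝ) : Prop :=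
  ∃ Λ : ∀ n : ℕ, Matrix ((Fin n → Fin d) × workSet E) ((Fin n → Fin d) × workSet E) ℂ →
      Matrix (workSet E) (workSet E) ℂ,
    (∀ n, IsThermalOperation β (addEnergy (copiesEnergy E n) (workEnergy E)) (workEnergy E) (Λ n)) ∧
    ∀ ρ ∈ S, HasWorkRate E Λ ρ (R ρ)

/-- The Umegaki relative entropy `D(ρ‖σ) = Tr[ρ log ρ - ρ log σ]` (natural logarithm), for a state
`ρ` and a positive definite state `σ`.  As `Real.log 0 = 0`, the kernel of `ρ` contributes zero. -/
def relEntropy {d : ℕ} (ρ σ : Matrix (Fin d) (Fin d) ℂ) : ℝ :=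
  (Matrix.trace (ρ * cfc Real.log ρ - ρ * cfc Real.log σ)).re

end Thermo

end

/-! Work extraction reduces to counting. Fix a basis of the n copies consisting of energy
eigenvectors and give each basis vector x a storage level w(x). Take a bath whose degeneracy grows
like e^{βE}. Raising the storage from 0 to w(x) is then an energy-conserving permutation of levels,
up to boundary effects in the bath, as soon as for every W ≠ 0 the vectors with w(x) = W carry at
most e^{-βW}/2 of the total Gibbs weight Z^n (`exists_perm_bath`,
`exists_thermalOperation_of_weights`).

The basis must not depend on ρ. Write ρ = B B†. Then B^{⊗n} is a combination of the 0-1 matrices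
A_T, one for each of the at most (n+1)^{d²} joint types T of row and column index, and its
coefficients satisfy |b_T|² |T| ≤ 1. Hence σ = ∑_T A_T A_T† / |T| dominates every column of every
B^{⊗n} up to the factor v = (n+1)^{d²}. Moreover Tr σ ≤ v, and σ is block diagonal for types of
sequences. Its type-homogeneous eigenvectors, with eigenvalues l(x), form the universal basis
(`exists_isUniversalBasis`).

When ρ^{⊗n} is measured in this basis, l(x) is close to e^{-nS(ρ)}: much smaller values contradict
domination, much larger ones are too few because of the trace bound. The energy has the i.i.d. law
given by the diagonal of ρ, since the basis respects types. So the score βE(x) + log l(x) + n log Z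
concentrates at n D(ρ‖τ) (`exists_concentration_const`). Taking βw(x) to be at most the score minus
log(2v) gives e^{-βE(x)} ≤ e^{-βW} Z^n l(x)/(2v) on each level set, and summing l yields the
counting condition (`sum_exp_workAssignment_le`).

The fidelity demands that nearly all weight reach one single level, so the score per copy is rounded
down to cells of width of order n^{-1/4}. A value D near a cell boundary would split the weight;
shifting the cells for odd n makes D interior for at least one of 2k and 2k+1, which is all that a
limsup needs (`exists_away_from_boundary`). The upper bound needs no general second law: in this
protocol a level clearly above nD/β is reached only from atypical x. -/

namespace Thermo

/-! ### Extending partial injections to permutations -/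

section Permutation

/-- An injection of a set `G` into its complement extends to an involution of the whole type. -/
theorem exists_perm_swap {T : Type*} (G : Set T) (g : T → T) (hg : Set.InjOn g G)
    (hG : ∀ s ∈ G, g s ∉ G) :
    ∃ f : Equiv.Perm T, (∀ s ∈ G, f s = g s) ∧ (∀ s ∈ G, f (g s) = s) ∧
      ∀ t, t ∉ G → (∀ s ∈ G, g s ≠ t) → f t = t := by
  classical
  let F : T → T := fun t => if t ∈ G then g t else
    if h : ∃ s, s ∈ G ∧ g s = t then h.choose else t
  have h1 : ∀ s ∈ G, F s = g s := fun s hs => by simp [F, hs]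
  have h2 : ∀ s ∈ G, F (g s) = s := by
    intro s hs
    have hex : ∃ s', s' ∈ G ∧ g s' = g s := ⟨s, hs, rfl⟩
    have : F (g s) = hex.choose := by simp only [F, if_neg (hG s hs), dif_pos hex]
    rw [this]
    exact hg hex.choose_spec.1 hs hex.choose_spec.2
  have h3 : ∀ t, t ∉ G → (∀ s ∈ G, g s ≠ t) → F t = t := by
    intro t ht hs
    have : ¬ ∃ s, s ∈ G ∧ g s = t := by rintro ⟨s, a, b⟩; exact hs s a b
    simp only [F, if_neg ht, dif_neg this]
  have hinv : Function.Involutive F := by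
    intro t
    by_cases ht : t ∈ G
    · rw [h1 t ht, h2 t ht]
    · by_cases hs : ∀ s ∈ G, g s ≠ t
      · rw [h3 t ht hs, h3 t ht hs]
      · push Not at hs
        obtain ⟨s, hs, rfl⟩ := hs
        rw [h2 s hs, h1 s hs]
  exact ⟨hinv.toPerm, h1, h2, h3⟩

end Permutation

/-! ### A unitary on one factor followed by a basis permutation -/

section Unitary

variable {X Y : Type*}

open Classical in
/-- The operator `U ⊗ 1`, followed by the permutation `f` of the basis. -/
noncomputable def permExtend (f : Equiv.Perm (X × Y)) (U : Matrix X X ℂ) :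
    Matrix (X × Y) (X × Y) ℂ :=
  fun i j => if (f.symm i).2 = j.2 then U (f.symm i).1 j.1 else 0

theorem conservesEnergy_permExtend (f : Equiv.Perm (X × Y)) {U : Matrix X X ℂ}
    (EX : X → ℝ) (EY : Y → ℝ) (hf : ∀ i, addEnergy EX EY (f i) = addEnergy EX EY i)
    (hU : ∀ a b, U a b ≠ 0 → EX a = EX b) :
    ConservesEnergy (addEnergy EX EY) (permExtend f U) := by
  intro i j
  have hi : addEnergy EX EY i = addEnergy EX EY (f.symm i) := by
    rw [← hf (f.symm i)]; simp
  rw [hi]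
  unfold permExtend
  split_ifs with h
  · by_cases h0 : U (f.symm i).1 j.1 = 0
    · simp [h0]
    · rw [addEnergy, addEnergy, hU _ _ h0, h]; ring
  · simp

variable [Fintype X]

theorem unitary_col [DecidableEq X] {U : Matrix X X ℂ} (hU : U ∈ Matrix.unitaryGroup X ℂ) (i j : X) :
    ∑ k, star (U k i) * U k j = if i = j then 1 else 0 := by
  have := congrFun (congrFun (Matrix.mem_unitaryGroup_iff'.1 hU) i) j
  simpa [Matrix.mul_apply, Matrix.one_apply, Matrix.star_apply] using this

theorem unitary_row [DecidableEq X] {U : Matrix X X ℂ} (hU : U ∈ Matrix.unitaryGroup X ℂ) (i j : X) :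
    ∑ k, U i k * star (U j k) = if i = j then 1 else 0 := by
  have := congrFun (congrFun (Matrix.mem_unitaryGroup_iff.1 hU) i) j
  simpa [Matrix.mul_apply, Matrix.one_apply, Matrix.star_apply] using this

theorem hasSum_prod_single {f : X × Y → ℂ} (y : Y) (hf : ∀ p : X × Y, p.2 ≠ y → f p = 0) :
    HasSum f (∑ x, f (x, y)) := by
  have hinj : Function.Injective (fun x : X => (x, y)) := fun a b h => (Prod.mk.inj h).1
  refine (hinj.hasSum_iff ?_).1 (hasSum_fintype _)
  intro p hp
  apply hf
  rintro rfl
  exact hp ⟨p.1, rfl⟩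

theorem permExtend_col [DecidableEq X] (f : Equiv.Perm (X × Y)) {U : Matrix X X ℂ}
    (hU : U ∈ Matrix.unitaryGroup X ℂ) (i j : X × Y) :
    HasSum (fun k => star (permExtend f U k i) * permExtend f U k j)
      (open Classical in if i = j then 1 else 0) := by
  classical
  rw [← f.hasSum_iff]
  have h := hasSum_prod_single (X := X)
    (f := (fun k => star (permExtend f U k i) * permExtend f U k j) ∘ f) i.2
    (by intro p hp; simp [permExtend, hp])
  convert h using 1
  by_cases hij : i.2 = j.2
  · simp only [permExtend, Function.comp, Equiv.symm_apply_apply, if_true, hij]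
    rw [unitary_col hU]
    simp [Prod.ext_iff, hij]
  · simp [permExtend, hij, Prod.ext_iff]

theorem permExtend_row [DecidableEq X] (f : Equiv.Perm (X × Y)) {U : Matrix X X ℂ}
    (hU : U ∈ Matrix.unitaryGroup X ℂ) (i j : X × Y) :
    HasSum (fun k => permExtend f U i k * star (permExtend f U j k))
      (open Classical in if i = j then 1 else 0) := by
  classical
  have h := hasSum_prod_single (X := X)
    (f := fun k => permExtend f U i k * star (permExtend f U j k)) (f.symm i).2
    (by intro p hp; simp [permExtend, Ne.symm hp])
  convert h using 1
  by_cases hij : (f.symm i).2 = (f.symm j).2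
  · simp only [permExtend, if_true, hij]
    rw [unitary_row hU]
    have : (i = j) ↔ (f.symm i).1 = (f.symm j).1 := by
      rw [← f.symm.injective.eq_iff, Prod.ext_iff]; simp [hij]
    simp [this]
  · have : i ≠ j := by rintro rfl; exact hij rfl
    simp [permExtend, Ne.symm hij, this]

theorem isUnitary_permExtend [DecidableEq X] (f : Equiv.Perm (X × Y)) {U : Matrix X X ℂ}
    (hU : U ∈ Matrix.unitaryGroup X ℂ) : IsUnitary (permExtend f U) := by
  refine ⟨fun i => ?_, fun i j hij => ?_, fun i => ?_, fun i j hij => ?_⟩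
  · simpa using permExtend_col f hU i i
  · simpa [hij] using permExtend_col f hU i j
  · simpa using permExtend_row f hU i i
  · simpa [hij] using permExtend_row f hU i j

/-- Since U acts on the first factor only, a diagonal entry sees a single label of the second
factor; coherences of `A` between different labels never enter. -/
theorem conjBy_permExtend_diag (f : Equiv.Perm (X × Y)) (U : Matrix X X ℂ)
    (A : Matrix (X × Y) (X × Y) ℂ) (i : X × Y) :
    conjBy (permExtend f U) A i i =
      ∑ a, ∑ b, U (f.symm i).1 a * A (a, (f.symm i).2) (b, (f.symm i).2) *
        star (U (f.symm i).1 b) := by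
  classical
  set y := (f.symm i).2
  have hinj : Function.Injective (fun p : X × X => (((p.1, y), (p.2, y)) : (X × Y) × (X × Y))) := by
    rintro ⟨a, b⟩ ⟨c, e⟩ h
    simp only [Prod.mk.injEq] at h
    simp [h.1.1, h.2.1]
  unfold conjBy
  rw [← hinj.tsum_eq, tsum_fintype, Fintype.sum_prod_type]
  · simp [permExtend, y]
  · rintro ⟨p, q⟩ hpq
    simp only [Function.mem_support, permExtend] at hpq
    by_cases hp : y = p.2
    · by_cases hq : y = q.2
      · exact ⟨(p.1, q.1), by simp only [hp]; ext <;> simp [← hp, hq]⟩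
      · simp [y] at hq; simp [hq] at hpq
    · simp [y] at hp; simp [hp] at hpq

end Unitary

/-! ### Relabelling of bases -/

section Reindex

theorem IsUnitary.submatrix {ι κ : Type*} {U : Matrix ι ι ℂ} (hU : IsUnitary U) (e : κ ≃ ι) :
    IsUnitary (U.submatrix e e) := by
  obtain ⟨h1, h2, h3, h4⟩ := hU
  refine ⟨fun i => ?_, fun i j hij => ?_, fun i => ?_, fun i j hij => ?_⟩
  · exact (e.hasSum_iff (f := fun k => star (U k (e i)) * U k (e i))).2 (h1 (e i))
  · exact (e.hasSum_iff (f := fun k => star (U k (e i)) * U k (e j))).2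
      (h2 (e i) (e j) (e.injective.ne hij))
  · exact (e.hasSum_iff (f := fun k => U (e i) k * star (U (e i) k))).2 (h3 (e i))
  · exact (e.hasSum_iff (f := fun k => U (e i) k * star (U (e j) k))).2
      (h4 (e i) (e j) (e.injective.ne hij))

theorem conjBy_submatrix {ι κ : Type*} (U A : Matrix ι ι ℂ) (e : κ ≃ ι) :
    conjBy (U.submatrix e e) (A.submatrix e e) = (conjBy U A).submatrix e e := by
  ext i j
  exact (Equiv.prodCongr e e).tsum_eq
    (fun p : ι × ι => U (e i) p.1 * A p.1 p.2 * star (U (e j) p.2))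

end Reindex

/-! ### Work distribution of a permutation protocol -/

section Fidelity

variable {d n : ℕ} {E : Fin d → ℝ} {κ : Type}

/-- The rearrangement of copies, storage and bath into storage and remainder. -/
def storageEquiv (X W κ : Type) : (X × W) × κ ≃ W × (X × κ) where
  toFun p := (p.1.2, (p.1.1, p.2))
  invFun p := ((p.2.1, p.1), p.2.2)
  left_inv _ := rfl
  right_inv _ := rfl

/-- The operation that applies `U` to the copies, permutes the basis by `f`, and discards
everything but the storage. -/
noncomputable def permOperation (β : ℝ) (EK : κ → ℝ) (U : Matrix (Fin n → Fin d) (Fin n → Fin d) ℂ)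
    (f : Equiv.Perm ((Fin n → Fin d) × (workSet E × κ)))
    (ρ : Matrix ((Fin n → Fin d) × workSet E) ((Fin n → Fin d) × workSet E) ℂ) :
    Matrix (workSet E) (workSet E) ℂ :=
  partialTrace ((conjBy
    ((permExtend f U).submatrix (Equiv.prodAssoc _ _ _) (Equiv.prodAssoc _ _ _))
    (ρ ⊗ₖ gibbs β EK)).submatrix (storageEquiv _ _ _).symm (storageEquiv _ _ _).symm)

theorem isThermalOperation_permOperation (β : ℝ) (EK : κ → ℝ)
    (hEK : Summable fun k => Real.exp (-β * EK k))
    {U : Matrix (Fin n → Fin d) (Fin n → Fin d) ℂ} (hU : U ∈ Matrix.unitaryGroup _ ℂ)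
    (hUE : ∀ x y, U x y ≠ 0 → copiesEnergy E n x = copiesEnergy E n y)
    (f : Equiv.Perm ((Fin n → Fin d) × (workSet E × κ)))
    (hf : ∀ i, addEnergy (copiesEnergy E n) (addEnergy (workEnergy E) EK) (f i) =
      addEnergy (copiesEnergy E n) (addEnergy (workEnergy E) EK) i) :
    IsThermalOperation β (addEnergy (copiesEnergy E n) (workEnergy E)) (workEnergy E)
      (permOperation β EK U f) := by
  refine ⟨κ, (Fin n → Fin d) × κ, EK, addEnergy (copiesEnergy E n) EK, storageEquiv _ _ _, _, hEK,
    ?_, (isUnitary_permExtend f hU).submatrix _, ?_, fun ρ _ => rfl⟩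
  · rintro ⟨⟨x, w⟩, k⟩
    simp only [addEnergy, storageEquiv, Equiv.coe_fn_mk]
    ring
  · intro i j
    have := conservesEnergy_permExtend f _ _ hf hUE (Equiv.prodAssoc _ _ _ i)
      (Equiv.prodAssoc _ _ _ j)
    simpa [addEnergy, add_assoc] using this

/-- The weight of the basis state `x` of the copies after the unitary `U`. -/
noncomputable def rotatedWeight {X : Type*} [Fintype X] (U ρ : Matrix X X ℂ) (x : X) : ℝ :=
  ((U * ρ * U.conjTranspose) x x).re

theorem rotatedWeight_nonneg {X : Type*} [Fintype X] {ρ : Matrix X X ℂ} (hρ : ρ.PosSemidef)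
    (U : Matrix X X ℂ) (x : X) : 0 ≤ rotatedWeight U ρ x :=
  (Complex.le_def.1 ((hρ.mul_mul_conjTranspose_same U).diag_nonneg (i := x))).1

/-- The fidelity with a storage level is a sum of diagonal entries, so the quantum protocol behaves
as a classical one: measure the copies in the basis given by U, sample the bath from its Gibbs
weights, then apply f. -/
theorem fidelity_permOperation [Fintype κ] (β : ℝ) (EK : κ → ℝ)
    (U : Matrix (Fin n → Fin d) (Fin n → Fin d) ℂ)
    (f : Equiv.Perm ((Fin n → Fin d) × (workSet E × κ)))
    (ρ : Matrix (Fin n → Fin d) (Fin n → Fin d) ℂ) (W : workSet E) :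
    fidelityBasis (permOperation β EK U f (ρ ⊗ₖ basisProj (workGround E))) W =
      ∑ x, ∑ k, (open Classical in if (f.symm (x, (W, k))).2.1 = workGround E then
        rotatedWeight U ρ (f.symm (x, (W, k))).1 *
          (Real.exp (-β * EK (f.symm (x, (W, k))).2.2) / partitionFn β EK) else 0) := by
  classical
  have key : ∀ (x : Fin n → Fin d) (k : κ), (conjBy
      ((permExtend f U).submatrix (Equiv.prodAssoc _ _ _) (Equiv.prodAssoc _ _ _))
      ((ρ ⊗ₖ basisProj (workGround E)) ⊗ₖ gibbs β EK) ((x, W), k) ((x, W), k)).re =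
      if (f.symm (x, (W, k))).2.1 = workGround E then
        rotatedWeight U ρ (f.symm (x, (W, k))).1 *
          (Real.exp (-β * EK (f.symm (x, (W, k))).2.2) / partitionFn β EK) else 0 := by
    intro x k
    have h1 : ((ρ ⊗ₖ basisProj (workGround E)) ⊗ₖ gibbs β EK) =
        (((ρ ⊗ₖ basisProj (workGround E)) ⊗ₖ gibbs β EK).submatrix (Equiv.prodAssoc _ _ _).symm
          (Equiv.prodAssoc _ _ _).symm).submatrix (Equiv.prodAssoc _ _ _)
            (Equiv.prodAssoc _ _ _) := by
      ext i j; simp [mul_assoc]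
    rw [h1, conjBy_submatrix, Matrix.submatrix_apply, conjBy_permExtend_diag]
    simp only [Equiv.prodAssoc_apply]
    generalize f.symm (x, (W, k)) = p
    obtain ⟨y, w, l⟩ := p
    simp only [Matrix.submatrix_apply, Equiv.prodAssoc_symm_apply, Matrix.kroneckerMap_apply,
      gibbs, Matrix.diagonal_apply_eq, basisProj, Matrix.single_apply, and_self]
    by_cases hw : workGround E = w
    · have hw' := hw.symm
      simp only [hw, if_true, mul_one]
      rw [rotatedWeight, ← Complex.re_mul_ofReal]
      congr 1
      simp only [Matrix.mul_apply, Matrix.conjTranspose_apply, Finset.sum_mul]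
      rw [Finset.sum_comm]
      refine Finset.sum_congr rfl fun a _ => Finset.sum_congr rfl fun b _ => ?_
      ring
    · simp [hw, Ne.symm hw]
  rw [fidelityBasis, permOperation, partialTrace, tsum_fintype, Complex.re_sum,
    Fintype.sum_prod_type]
  refine Finset.sum_congr rfl fun x _ => Finset.sum_congr rfl fun k _ => ?_
  exact key x k

theorem sum_gibbs_weight [Fintype κ] [Nonempty κ] (β : ℝ) (EK : κ → ℝ) :
    ∑ k, Real.exp (-β * EK k) / partitionFn β EK = 1 := by
  rw [← Finset.sum_div, partitionFn, tsum_fintype]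
  exact div_self (Finset.sum_pos (fun _ _ => Real.exp_pos _) Finset.univ_nonempty).ne'

/-- Bounds on the work distribution when the permutation `f` raises the storage from its ground
state to `w x` for all bath states in `good`. -/
theorem fidelity_permOperation_bounds [Fintype κ] [Nonempty κ] (β : ℝ) (EK : κ → ℝ)
    (U : Matrix (Fin n → Fin d) (Fin n → Fin d) ℂ)
    (f : Equiv.Perm ((Fin n → Fin d) × (workSet E × κ))) (w : (Fin n → Fin d) → workSet E)
    (good : Finset κ) {η : ℝ}
    (hgood : 1 - η ≤ ∑ k ∈ good, Real.exp (-β * EK k) / partitionFn β EK)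
    (hf₁ : ∀ x, ∀ k ∈ good, (f (x, (workGround E, k))).2.1 = w x)
    (hf₂ : ∀ x k, (f (x, (workGround E, k))).2.1 = w x ∨
      (f (x, (workGround E, k))).2.1 = workGround E)
    {ρ : Matrix (Fin n → Fin d) (Fin n → Fin d) ℂ} (hρ : ρ.PosSemidef) (W : workSet E) :
    (1 - η) * (∑ x, open Classical in if w x = W then rotatedWeight U ρ x else 0) ≤
        fidelityBasis (permOperation β EK U f (ρ ⊗ₖ basisProj (workGround E))) W ∧
      (W ≠ workGround E →
        fidelityBasis (permOperation β EK U f (ρ ⊗ₖ basisProj (workGround E))) W ≤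
          ∑ x, open Classical in if w x = W then rotatedWeight U ρ x else 0) := by
  classical
  rw [fidelity_permOperation]
  set γ : κ → ℝ := fun k => Real.exp (-β * EK k) / partitionFn β EK with hγ
  have hγ0 : ∀ k, 0 ≤ γ k := fun k => div_nonneg (Real.exp_pos _).le
    (tsum_nonneg fun _ => (Real.exp_pos _).le)
  have hP0 := rotatedWeight_nonneg hρ U
  set P := rotatedWeight U ρ
  set S : Finset ((Fin n → Fin d) × κ) :=
    Finset.univ.filter (fun p => (f.symm (p.1, (W, p.2))).2.1 = workGround E) with hS
  have hfid : (∑ x, ∑ k, if (f.symm (x, (W, k))).2.1 = workGround E then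
      P (f.symm (x, (W, k))).1 * γ (f.symm (x, (W, k))).2.2 else 0) =
      ∑ p ∈ S, P (f.symm (p.1, (W, p.2))).1 * γ (f.symm (p.1, (W, p.2))).2.2 := by
    rw [hS, Finset.sum_filter, Fintype.sum_prod_type]
  -- Reindexing along f: the final states with storage W that come from the ground state correspond
  -- to the initial states that f sends to W.
  have himage : (∑ p ∈ S, P (f.symm (p.1, (W, p.2))).1 * γ (f.symm (p.1, (W, p.2))).2.2) =
      ∑ p ∈ Finset.univ.filter (fun p : (Fin n → Fin d) × κ =>
        (f (p.1, (workGround E, p.2))).2.1 = W), P p.1 * γ p.2 := by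
    refine Finset.sum_bij' (fun p _ => ((f.symm (p.1, (W, p.2))).1, (f.symm (p.1, (W, p.2))).2.2))
      (fun p _ => ((f (p.1, (workGround E, p.2))).1, (f (p.1, (workGround E, p.2))).2.2))
      ?_ ?_ ?_ ?_ ?_
    · rintro ⟨x, k⟩ h
      simp only [hS, Finset.mem_filter, Finset.mem_univ, true_and] at h ⊢
      rw [← h]
      simp
    · rintro ⟨x, k⟩ h
      simp only [hS, Finset.mem_filter, Finset.mem_univ, true_and] at h ⊢
      rw [← h]
      simp
    · rintro ⟨x, k⟩ h
      simp only [hS, Finset.mem_filter, Finset.mem_univ, true_and] at h ⊢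
      rw [← h]
      simp
    · rintro ⟨x, k⟩ h
      simp only [Finset.mem_filter, Finset.mem_univ, true_and] at h ⊢
      rw [← h]
      simp
    · intro p h
      rfl
  change _ ≤ (∑ x, ∑ k, if (f.symm (x, (W, k))).2.1 = workGround E then
      P (f.symm (x, (W, k))).1 * γ (f.symm (x, (W, k))).2.2 else 0) ∧
      (_ → (∑ x, ∑ k, if (f.symm (x, (W, k))).2.1 = workGround E then
      P (f.symm (x, (W, k))).1 * γ (f.symm (x, (W, k))).2.2 else 0) ≤ _)
  rw [hfid, himage]
  constructor
  · calc (1 - η) * ∑ x, (if w x = W then P x else 0)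
        ≤ (∑ k ∈ good, γ k) * ∑ x, (if w x = W then P x else 0) :=
          mul_le_mul_of_nonneg_right hgood (Finset.sum_nonneg fun x _ => by
            split_ifs <;> simp [hP0])
      _ = ∑ p ∈ (Finset.univ.filter fun x => w x = W) ×ˢ good, P p.1 * γ p.2 := by
          rw [Finset.sum_product, ← Finset.sum_filter, mul_comm, Finset.sum_mul_sum]
      _ ≤ _ := by
          refine Finset.sum_le_sum_of_subset_of_nonneg ?_ fun p _ _ => mul_nonneg (hP0 _) (hγ0 _)
          rintro ⟨x, k⟩ h
          simp only [Finset.mem_product, Finset.mem_filter, Finset.mem_univ, true_and] at h ⊢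
          rw [hf₁ x k h.2, h.1]
  -- A failed start leaves the storage in its ground state, so it cannot contribute to W ≠ 0; every
  -- contribution then has w x = W.
  · intro hW
    calc _ ≤ ∑ p ∈ (Finset.univ.filter fun x => w x = W) ×ˢ (Finset.univ : Finset κ),
          P p.1 * γ p.2 := by
          refine Finset.sum_le_sum_of_subset_of_nonneg ?_ fun p _ _ => mul_nonneg (hP0 _) (hγ0 _)
          rintro ⟨x, k⟩ h
          simp only [Finset.mem_product, Finset.mem_filter, Finset.mem_univ, true_and,
            and_true] at h ⊢
          rcases hf₂ x k with h' | h'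
          · rw [← h', h]
          · exact absurd (h.symm.trans h') hW
      _ = (∑ x, if w x = W then P x else 0) * ∑ k, γ k := by
          rw [Finset.sum_product, ← Finset.sum_filter, Finset.sum_mul_sum]
      _ = _ := by rw [hγ, sum_gibbs_weight, mul_one]

end Fidelity

/-! ### Types of sequences -/

section Types

/-- The type of a sequence: the number of occurrences of each letter. -/
def typeCount {α : Type*} [DecidableEq α] {n : ℕ} (x : Fin n → α) (a : α) : ℕ :=
  (Finset.univ.filter fun j => x j = a).card

theorem typeCount_le {α : Type*} [DecidableEq α] {n : ℕ} (x : Fin n → α) (a : α) :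
    typeCount x a ≤ n := (Finset.card_le_univ _).trans (by simp)

theorem copiesEnergy_eq_sum_typeCount {d n : ℕ} (E : Fin d → ℝ) (x : Fin n → Fin d) :
    copiesEnergy E n x = ∑ i, (typeCount x i : ℝ) * E i := by
  unfold copiesEnergy typeCount
  rw [← Finset.sum_fiberwise (s := Finset.univ) (g := x) (f := fun j => E (x j))]
  refine Finset.sum_congr rfl fun i _ => ?_
  rw [Finset.sum_congr rfl (g := fun _ => E i) (by
    intro j hj; rw [(Finset.mem_filter.1 hj).2])]
  simp

end Types

/-! ### Counting levels in a bath of exponentially growing degeneracy -/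

section Bath

variable {d n : ℕ}

/-- The energy `∑ i, K i * E i` of an occupation vector `K`. -/
def occEnergy (E : Fin d → ℝ) (K : Fin d → ℤ) : ℝ := ∑ i, (K i : ℝ) * E i

theorem occEnergy_add (E : Fin d → ℝ) (K L : Fin d → ℤ) :
    occEnergy E (K + L) = occEnergy E K + occEnergy E L := by
  simp [occEnergy, add_mul, Finset.sum_add_distrib]

theorem occEnergy_sub (E : Fin d → ℝ) (K L : Fin d → ℤ) :
    occEnergy E (K - L) = occEnergy E K - occEnergy E L := by
  simp [occEnergy, sub_mul, Finset.sum_sub_distrib]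

/-- The type of a sequence as an integer vector. -/
def typeVec (x : Fin n → Fin d) (i : Fin d) : ℤ := typeCount x i

theorem occEnergy_typeVec (E : Fin d → ℝ) (x : Fin n → Fin d) :
    occEnergy E (typeVec x) = copiesEnergy E n x := by
  simp [occEnergy, typeVec, copiesEnergy_eq_sum_typeCount]

/-- Basis states of a bath with `g K` levels for each occupation vector `K ∈ B`. -/
abbrev BathIndex (B : Finset (Fin d → ℤ)) (g : (Fin d → ℤ) → ℕ) : Type :=
  Σ K : B, Fin (g K)

theorem card_filter_bath (B : Finset (Fin d → ℤ)) (g : (Fin d → ℤ) → ℕ)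
    (p : (Fin n → Fin d) → Prop) [DecidablePred p] (h : (Fin n → Fin d) → Fin d → ℤ) :
    (((Finset.univ.filter fun q : (Fin n → Fin d) × BathIndex B g =>
      p q.1 ∧ (q.2.1 : Fin d → ℤ) = h q.1).card : ℕ) : ℝ) =
      ∑ x, if p x ∧ h x ∈ B then (g (h x) : ℝ) else 0 := by
  rw [Finset.card_filter]
  push_cast
  rw [Fintype.sum_prod_type]
  refine Finset.sum_congr rfl fun x _ => ?_
  rw [Fintype.sum_sigma]
  by_cases hp : p x
  · simp only [hp, true_and, Finset.sum_const, Finset.card_univ, Fintype.card_fin, nsmul_eq_mul]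
    rw [Finset.sum_coe_sort B (fun K => (g K : ℝ) * if K = h x then 1 else 0)]
    simp
  · simp [hp]

/-- If the levels of the bath grow like `e^{β E}`, there is an energy conserving permutation which,
away from the boundary of the bath, raises the storage from its ground state to `w x`. -/
theorem exists_perm_bath (β : ℝ) (E : Fin d → ℝ) (B : Finset (Fin d → ℤ)) (g : (Fin d → ℤ) → ℕ)
    {C : ℝ} (hC : 0 < C) (hg₁ : ∀ K ∈ B, C * Real.exp (β * occEnergy E K) ≤ g K)
    (hg₂ : ∀ K ∈ B, (g K : ℝ) ≤ 2 * C * Real.exp (β * occEnergy E K))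
    (w : (Fin n → Fin d) → workSet E) (N : workSet E → Fin d → ℤ)
    (hN : ∀ W : workSet E, (W : ℝ) = occEnergy E (N W))
    (hw : ∀ W, W ≠ workGround E →
      2 * (∑ x, open Classical in if w x = W then Real.exp (-β * copiesEnergy E n x) else 0) ≤
        Real.exp (-β * W) * ∑ x, Real.exp (-β * copiesEnergy E n x)) :
    ∃ f : Equiv.Perm ((Fin n → Fin d) × (workSet E × BathIndex B g)),
      (∀ i, addEnergy (copiesEnergy E n) (addEnergy (workEnergy E) fun k => occEnergy E k.1) (f i) =
        addEnergy (copiesEnergy E n) (addEnergy (workEnergy E) fun k => occEnergy E k.1) i) ∧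
      (∀ x k, (∀ x' : Fin n → Fin d,
        typeVec x + (k.1 : Fin d → ℤ) - N (w x) - typeVec x' ∈ B) →
        (f (x, (workGround E, k))).2.1 = w x) ∧
      (∀ x k, (f (x, (workGround E, k))).2.1 = w x ∨
        (f (x, (workGround E, k))).2.1 = workGround E) := by
  classical
  let κ := BathIndex B g
  -- Levels are sorted by the total occupation vector L of copies, storage and bath. Equal vectors
  -- force equal energy, whatever coincidences the energies E i may have. An initial storage in its
  -- ground state counts as the zero vector.
  let inS : workSet E → (Fin d → ℤ) → Finset ((Fin n → Fin d) × κ) := fun W L =>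
    Finset.univ.filter fun q => w q.1 = W ∧ (q.2.1 : Fin d → ℤ) = L - typeVec q.1
  let outS : workSet E → (Fin d → ℤ) → Finset ((Fin n → Fin d) × κ) := fun W L =>
    Finset.univ.filter fun q => True ∧ (q.2.1 : Fin d → ℤ) = L - N W - typeVec q.1
  let ok : workSet E → (Fin d → ℤ) → Prop := fun W L =>
    W ≠ workGround E ∧ ∀ x' : Fin n → Fin d, L - N W - typeVec x' ∈ B
  -- The source has at most 2C e^{βE(L)} ∑_{w x = W} e^{-βE(x)} states, the target at least C
  -- e^{βE(L)} e^{-βW} ∑ e^{-βE(x)}. The factor 2 in `hw` pays for the slack between `hg₁` and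
  -- `hg₂`.
  have hcard : ∀ W L, ok W L → (inS W L).card ≤ (outS W L).card := by
    rintro W L ⟨hW, hL⟩
    have : ((inS W L).card : ℝ) ≤ (outS W L).card := by
      rw [card_filter_bath B g (fun x => w x = W) (fun x => L - typeVec x),
        card_filter_bath B g (fun _ => True) (fun x => L - N W - typeVec x)]
      set c := C * Real.exp (β * occEnergy E L) with hc
      have hc0 : 0 < c := mul_pos hC (Real.exp_pos _)
      calc _ ≤ ∑ x, c * (2 * if w x = W then Real.exp (-β * copiesEnergy E n x) else 0) := by
            refine Finset.sum_le_sum fun x _ => ?_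
            split_ifs with h1 h2 h2
            · refine (hg₂ _ h1.2).trans (le_of_eq ?_)
              rw [occEnergy_sub, occEnergy_typeVec, hc, mul_sub, Real.exp_sub, neg_mul,
                Real.exp_neg]
              field_simp
            · exact absurd h1.1 h2
            · have := Real.exp_pos (-β * copiesEnergy E n x)
              positivity
            · simp
        _ = c * (2 * ∑ x, if w x = W then Real.exp (-β * copiesEnergy E n x) else 0) := by
            rw [← Finset.mul_sum, ← Finset.mul_sum]
        _ ≤ c * (Real.exp (-β * W) * ∑ x : Fin n → Fin d, Real.exp (-β * copiesEnergy E n x)) :=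
            mul_le_mul_of_nonneg_left (hw W hW) hc0.le
        _ = ∑ x : Fin n → Fin d, c * (Real.exp (-β * W) * Real.exp (-β * copiesEnergy E n x)) := by
            rw [Finset.mul_sum, Finset.mul_sum]
        _ ≤ _ := by
            refine Finset.sum_le_sum fun x _ => ?_
            rw [if_pos ⟨trivial, hL x⟩]
            refine le_trans (le_of_eq ?_) (hg₁ _ (hL x))
            rw [occEnergy_sub, occEnergy_sub, occEnergy_typeVec, ← hN, hc, mul_assoc,
              ← Real.exp_add, ← Real.exp_add]
            congr 2
            ring
    exact_mod_cast this
  have hemb : ∀ W L, ∃ φ : (Fin n → Fin d) × κ → (Fin n → Fin d) × κ, ok W L →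
      (∀ q ∈ inS W L, φ q ∈ outS W L) ∧ Set.InjOn φ (inS W L) := by
    intro W L
    by_cases h : ok W L
    · rcases isEmpty_or_nonempty ((Fin n → Fin d) × κ) with he | he
      · exact ⟨id, fun _ => ⟨fun q => he.elim q, fun q => he.elim q⟩⟩
      · obtain ⟨φ, h1, h2⟩ := (inS W L).finite_toSet.exists_injOn_of_encard_le
          (t := (↑(outS W L) : Set ((Fin n → Fin d) × κ))) (by simpa using hcard W L h)
        exact ⟨φ, fun _ => ⟨fun q hq => h1 hq, h2⟩⟩
    · exact ⟨id, fun h' => absurd h' h⟩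
  choose φ hφ using hemb
  let T := (Fin n → Fin d) × (workSet E × κ)
  let tot : T → Fin d → ℤ := fun t => typeVec t.1 + t.2.2.1
  let G : Set T := {t | t.2.1 = workGround E ∧ ok (w t.1) (tot t)}
  let gm : T → T := fun t =>
    ((φ (w t.1) (tot t) (t.1, t.2.2)).1, (w t.1, (φ (w t.1) (tot t) (t.1, t.2.2)).2))
  have hin : ∀ t : T, (t.1, t.2.2) ∈ inS (w t.1) (tot t) := by
    intro t
    simp [inS, tot]
  have hout : ∀ t ∈ G, typeVec (gm t).1 + N (w t.1) + (gm t).2.2.1 = tot t := by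
    intro t ht
    have := (hφ _ _ ht.2).1 _ (hin t)
    simp only [outS, Finset.mem_filter, Finset.mem_univ, true_and] at this
    simp only [gm]
    rw [this]
    abel
  -- The image reveals which injection φ was used: its storage label gives W, and W with the
  -- remaining occupations gives L.
  have hinj : Set.InjOn gm G := by
    intro s hs t ht hst
    have h1 : w s.1 = w t.1 := congrArg (fun u : T => u.2.1) hst
    have h2 : tot s = tot t := by rw [← hout s hs, ← hout t ht, hst, h1]
    have h3 : φ (w s.1) (tot s) (s.1, s.2.2) = φ (w t.1) (tot t) (t.1, t.2.2) :=
      Prod.ext (congrArg (fun u : T => u.1) hst) (congrArg (fun u : T => u.2.2) hst)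
    have h4 := hin s
    rw [h1, h2] at h3 h4
    have h5 := (hφ _ _ ht.2).2 h4 (hin t) h3
    obtain ⟨x, W, k⟩ := s
    obtain ⟨x', W', k'⟩ := t
    simp only [Prod.mk.injEq] at h5
    obtain ⟨rfl, rfl⟩ := h5
    have h6 : W = workGround E := hs.1
    have h7 : W' = workGround E := ht.1
    rw [h6, h7]
  have hdisj : ∀ s ∈ G, gm s ∉ G := fun s hs h => hs.2.1 h.1
  obtain ⟨f, hf1, hf2, hf3⟩ := exists_perm_swap G gm hinj hdisj
  have henergy : ∀ t ∈ G,
      addEnergy (copiesEnergy E n) (addEnergy (workEnergy E) fun k : κ => occEnergy E k.1) (gm t) =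
      addEnergy (copiesEnergy E n) (addEnergy (workEnergy E) fun k : κ => occEnergy E k.1) t := by
    intro t ht
    have h := congrArg (occEnergy E) (hout t ht)
    simp only [tot, occEnergy_add, occEnergy_typeVec, ← hN] at h
    have h0 : workEnergy E t.2.1 = 0 := by rw [ht.1]; rfl
    have h1 : workEnergy E (gm t).2.1 = (w t.1 : ℝ) := rfl
    simp only [addEnergy, h0, h1]
    linarith
  have hfix : ∀ x k, (x, (workGround E, k)) ∉ G →
      f (x, (workGround E, k)) = (x, (workGround E, k)) := by
    intro x k h
    refine hf3 _ h fun s hs hs' => hs.2.1 (congrArg (fun u : T => u.2.1) hs')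
  refine ⟨f, fun i => ?_, fun x k h => ?_, fun x k => ?_⟩
  · by_cases hi : i ∈ G
    · rw [hf1 i hi, henergy i hi]
    · by_cases hs : ∀ s ∈ G, gm s ≠ i
      · rw [hf3 i hi hs]
      · push Not at hs
        obtain ⟨s, hs, rfl⟩ := hs
        rw [hf2 s hs, henergy s hs]
  · by_cases hx : w x = workGround E
    · rw [hfix x k fun hG => hG.2.1 hx, hx]
    · rw [hf1 (x, (workGround E, k)) ⟨rfl, hx, h⟩]
  · by_cases hG : (x, (workGround E, k)) ∈ G
    · left; rw [hf1 _ hG]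
    · right; rw [hfix x k hG]

end Bath

/-! ### From a work assignment to a thermal operation -/

section Protocol

variable {d n : ℕ}

theorem sum_bath (B : Finset (Fin d → ℤ)) (g : (Fin d → ℤ) → ℕ) (F : (Fin d → ℤ) → ℝ) :
    ∑ k : BathIndex B g, F k.1 = ∑ K ∈ B, g K * F K := by
  rw [Fintype.sum_sigma]
  simp only [Finset.sum_const, Finset.card_univ, Fintype.card_fin, nsmul_eq_mul]
  exact Finset.sum_coe_sort B (fun K => (g K : ℝ) * F K)

/-- In a large box, most of the weight of the bath is at distance more than `c` from the
boundary. -/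
theorem gibbs_weight_good (β : ℝ) (E : Fin d → ℝ) (M c : ℕ) (g : (Fin d → ℤ) → ℕ) {C η : ℝ}
    (hC : 0 < C) (hη : 0 < η) (hM : 2 * c < M) (hMη : 4 * c * d / η ≤ M)
    (hg₁ : ∀ K ∈ Fintype.piFinset (fun _ : Fin d => Finset.Ico (0 : ℤ) M),
      C * Real.exp (β * occEnergy E K) ≤ g K)
    (hg₂ : ∀ K ∈ Fintype.piFinset (fun _ : Fin d => Finset.Ico (0 : ℤ) M),
      (g K : ℝ) ≤ 2 * C * Real.exp (β * occEnergy E K)) :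
    1 - η ≤ ∑ k ∈ Finset.univ.filter (fun k : BathIndex
        (Fintype.piFinset (fun _ : Fin d => Finset.Ico (0 : ℤ) M)) g =>
        ∀ i, (c : ℤ) ≤ k.1.1 i ∧ k.1.1 i < M - c),
      Real.exp (-β * occEnergy E k.1) / partitionFn β
        (fun k : BathIndex (Fintype.piFinset (fun _ : Fin d => Finset.Ico (0 : ℤ) M)) g =>
          occEnergy E k.1) := by
  set B := Fintype.piFinset (fun _ : Fin d => Finset.Ico (0 : ℤ) M) with hB
  set I := Fintype.piFinset (fun _ : Fin d => Finset.Ico (c : ℤ) (M - c)) with hI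
  have hM0 : (0 : ℝ) < M := by exact_mod_cast (by omega : 0 < M)
  have hBcard : (B.card : ℝ) = (M : ℝ) ^ d := by simp [hB, Fintype.card_piFinset]
  have hIcard : (I.card : ℝ) = ((M : ℝ) - 2 * c) ^ d := by
    have : ((M : ℤ) - c - c).toNat = M - 2 * c := by omega
    rw [hI, Fintype.card_piFinset]
    simp only [Int.card_Ico, this, Finset.prod_const, Finset.card_univ, Fintype.card_fin]
    push_cast [Nat.cast_sub hM.le]
    rfl
  have hIB : I ⊆ B := by
    intro K hK
    simp only [hI, hB, Fintype.mem_piFinset, Finset.mem_Ico] at hK ⊢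
    intro i
    have := hK i
    omega
  have hexp : ∀ K, Real.exp (β * occEnergy E K) * Real.exp (-β * occEnergy E K) = 1 := by
    intro K
    rw [← Real.exp_add]
    simp
  set Z := partitionFn β (fun k : BathIndex B g => occEnergy E k.1) with hZ
  have hZeq : Z = ∑ K ∈ B, g K * Real.exp (-β * occEnergy E K) := by
    rw [hZ, partitionFn, tsum_fintype]
    exact sum_bath B g (fun K => Real.exp (-β * occEnergy E K))
  -- Each K in the box carries between C and 2C of unnormalised Gibbs weight, so the estimate
  -- reduces to comparing numbers of lattice points.
  have hZlow : C * (M : ℝ) ^ d ≤ Z := by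
    rw [hZeq, ← hBcard, mul_comm, ← nsmul_eq_mul, ← Finset.sum_const]
    refine Finset.sum_le_sum fun K hK => ?_
    calc C = C * Real.exp (β * occEnergy E K) * Real.exp (-β * occEnergy E K) := by
          rw [mul_assoc, hexp, mul_one]
      _ ≤ _ := mul_le_mul_of_nonneg_right (hg₁ K hK) (Real.exp_pos _).le
  have hZpos : 0 < Z := lt_of_lt_of_le (by positivity) hZlow
  have hgood : ∑ k ∈ Finset.univ.filter (fun k : BathIndex B g =>
        ∀ i, (c : ℤ) ≤ k.1.1 i ∧ k.1.1 i < M - c), Real.exp (-β * occEnergy E k.1) / Z =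
      (∑ K ∈ I, g K * Real.exp (-β * occEnergy E K)) / Z := by
    rw [← Finset.sum_div, Finset.sum_filter]
    congr 1
    rw [sum_bath B g (fun K => if ∀ i, (c : ℤ) ≤ K i ∧ K i < M - c then
      Real.exp (-β * occEnergy E K) else 0)]
    rw [← Finset.sum_subset hIB]
    · refine Finset.sum_congr rfl fun K hK => ?_
      simp only [hI, Fintype.mem_piFinset, Finset.mem_Ico] at hK
      rw [if_pos hK]
    · intro K _ hK
      simp only [hI, Fintype.mem_piFinset, Finset.mem_Ico] at hK
      rw [if_neg hK, mul_zero]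
  have hbad : Z - ∑ K ∈ I, g K * Real.exp (-β * occEnergy E K) ≤
      2 * C * ((M : ℝ) ^ d - ((M : ℝ) - 2 * c) ^ d) := by
    rw [hZeq, ← Finset.sum_sdiff hIB, add_sub_cancel_right, ← hBcard, ← hIcard,
      ← Nat.cast_sub (Finset.card_le_card hIB), ← Finset.card_sdiff_of_subset hIB, mul_comm,
      ← nsmul_eq_mul, ← Finset.sum_const]
    refine Finset.sum_le_sum fun K hK => ?_
    calc _ ≤ 2 * C * Real.exp (β * occEnergy E K) * Real.exp (-β * occEnergy E K) :=
          mul_le_mul_of_nonneg_right (hg₂ K (Finset.sdiff_subset hK)) (Real.exp_pos _).le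
      _ = 2 * C := by rw [mul_assoc, hexp, mul_one]
  -- Bernoulli's inequality for (1 - 2c/M)^d bounds the number of points in the boundary layer.
  have hbern : (M : ℝ) ^ d - ((M : ℝ) - 2 * c) ^ d ≤ (M : ℝ) ^ d * (2 * c * d / M) := by
    have hcM : 2 * (c : ℝ) / M ≤ 1 := by
      rw [div_le_one hM0]; exact_mod_cast hM.le
    have h := one_add_mul_le_pow (a := -(2 * (c : ℝ) / M)) (by linarith) d
    have h2 : ((M : ℝ) - 2 * c) ^ d = (M : ℝ) ^ d * (1 + -(2 * (c : ℝ) / M)) ^ d := by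
      rw [← mul_pow]
      congr 1
      field_simp
      ring
    rw [h2]
    have h3 := mul_le_mul_of_nonneg_left h (pow_nonneg hM0.le d)
    have h4 : (M : ℝ) ^ d * (1 + d * -(2 * (c : ℝ) / M)) =
      (M : ℝ) ^ d - (M : ℝ) ^ d * (2 * c * d / M) := by ring
    linarith
  have hη' : 2 * (2 * c * d / (M : ℝ)) ≤ η := by
    rw [div_le_iff₀ hη] at hMη
    rw [← mul_div_assoc, div_le_iff₀ hM0]
    linarith
  rw [hgood, le_div_iff₀ hZpos]
  have h5 : 2 * C * ((M : ℝ) ^ d - ((M : ℝ) - 2 * c) ^ d) ≤ η * Z := by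
    calc _ ≤ 2 * C * ((M : ℝ) ^ d * (2 * c * d / M)) := by
          exact mul_le_mul_of_nonneg_left hbern (by positivity)
      _ = (2 * (2 * c * d / (M : ℝ))) * (C * (M : ℝ) ^ d) := by ring
      _ ≤ η * (C * (M : ℝ) ^ d) := mul_le_mul_of_nonneg_right hη' (by positivity)
      _ ≤ η * Z := mul_le_mul_of_nonneg_left hZlow hη.le
  linarith

/-- A work assignment `w` whose level sets are small enough, measured by their Gibbs weight, is
realised by a thermal operation up to an arbitrarily small error. -/
theorem exists_thermalOperation_of_weights (β : ℝ) (E : Fin d → ℝ)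
    {U : Matrix (Fin n → Fin d) (Fin n → Fin d) ℂ} (hU : U ∈ Matrix.unitaryGroup _ ℂ)
    (hUE : ∀ x y, U x y ≠ 0 → copiesEnergy E n x = copiesEnergy E n y)
    (w : (Fin n → Fin d) → workSet E)
    (hw : ∀ W, W ≠ workGround E →
      2 * (∑ x, open Classical in if w x = W then Real.exp (-β * copiesEnergy E n x) else 0) ≤
        Real.exp (-β * W) * ∑ x, Real.exp (-β * copiesEnergy E n x))
    {η : ℝ} (hη : 0 < η) :
    ∃ Λ : Matrix ((Fin n → Fin d) × workSet E) ((Fin n → Fin d) × workSet E) ℂ →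
        Matrix (workSet E) (workSet E) ℂ,
      IsThermalOperation β (addEnergy (copiesEnergy E n) (workEnergy E)) (workEnergy E) Λ ∧
      ∀ ρ : Matrix (Fin n → Fin d) (Fin n → Fin d) ℂ, ρ.PosSemidef → ∀ W : workSet E,
        (1 - η) * (∑ x, open Classical in if w x = W then rotatedWeight U ρ x else 0) ≤
            fidelityBasis (Λ (ρ ⊗ₖ basisProj (workGround E))) W ∧
          (W ≠ workGround E → fidelityBasis (Λ (ρ ⊗ₖ basisProj (workGround E))) W ≤
            ∑ x, open Classical in if w x = W then rotatedWeight U ρ x else 0) := by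
  classical
  have hN : ∀ W : workSet E, ∃ N : Fin d → ℤ, (W : ℝ) = occEnergy E N :=
    fun W => ⟨W.2.2.choose, W.2.2.choose_spec.2⟩
  choose N hN using hN
  -- The bath vector changes by typeVec x - N (w x) - typeVec x', hence by at most n + |N (w x) i|
  -- in coordinate i; c bounds this for all x at once.
  set c : ℕ := n + ∑ x : Fin n → Fin d, ∑ i, (N (w x) i).natAbs with hc
  have hcN : ∀ (x : Fin n → Fin d) i, n + (N (w x) i).natAbs ≤ c := by
    intro x i
    have h1 := Finset.single_le_sum (f := fun i => (N (w x) i).natAbs)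
      (fun _ _ => Nat.zero_le _) (Finset.mem_univ i)
    have h2 := Finset.single_le_sum (f := fun x => ∑ i, (N (w x) i).natAbs)
      (fun _ _ => Nat.zero_le _) (Finset.mem_univ x)
    omega
  obtain ⟨M₀, hM₀⟩ := exists_nat_ge (4 * c * d / η)
  set M := M₀ + 2 * c + 1 with hM
  have hMη : 4 * c * d / η ≤ M := hM₀.trans (by exact_mod_cast (by omega))
  set B := Fintype.piFinset (fun _ : Fin d => Finset.Ico (0 : ℤ) M) with hB
  -- This C makes C e^{βE(K)} ≥ 1 on the box, so rounding up to an integer degeneracy at most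
  -- doubles it.
  set C : ℝ := ∑ K ∈ B, Real.exp (-β * occEnergy E K) with hCdef
  have h0B : (0 : Fin d → ℤ) ∈ B := by
    simp only [hB, Fintype.mem_piFinset, Finset.mem_Ico, Pi.zero_apply]
    intro i
    omega
  have hC : 0 < C := Finset.sum_pos (fun _ _ => Real.exp_pos _) ⟨0, h0B⟩
  have hCK : ∀ K ∈ B, 1 ≤ C * Real.exp (β * occEnergy E K) := by
    intro K hK
    calc 1 = Real.exp (-β * occEnergy E K) * Real.exp (β * occEnergy E K) := by
          rw [← Real.exp_add]; simp
      _ ≤ _ := mul_le_mul_of_nonneg_right (Finset.single_le_sum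
          (f := fun K => Real.exp (-β * occEnergy E K)) (fun _ _ => (Real.exp_pos _).le) hK)
          (Real.exp_pos _).le
  set g : (Fin d → ℤ) → ℕ := fun K => ⌈C * Real.exp (β * occEnergy E K)⌉₊ with hg
  have hg₁ : ∀ K ∈ B, C * Real.exp (β * occEnergy E K) ≤ g K := fun K _ => Nat.le_ceil _
  have hg₂ : ∀ K ∈ B, (g K : ℝ) ≤ 2 * C * Real.exp (β * occEnergy E K) := by
    intro K hK
    have h1 := Nat.ceil_lt_add_one (zero_le_one.trans (hCK K hK))
    have h2 := hCK K hK
    simp only [hg]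
    linarith
  obtain ⟨f, hf0, hf1, hf2⟩ := exists_perm_bath β E B g hC hg₁ hg₂ w N hN hw
  have hg0 : 0 < g 0 := by
    have h1 := (hCK 0 h0B).trans (hg₁ 0 h0B)
    have h2 : (1 : ℝ) ≤ (g 0 : ℝ) := h1
    exact_mod_cast h2
  have : Nonempty (BathIndex B g) := ⟨⟨⟨0, h0B⟩, ⟨0, hg0⟩⟩⟩
  refine ⟨permOperation β (fun k : BathIndex B g => occEnergy E k.1) U f,
    isThermalOperation_permOperation β _ (hasSum_fintype _).summable hU hUE f hf0, ?_⟩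
  intro ρ hρ W
  refine fidelity_permOperation_bounds β _ U f w _
    (gibbs_weight_good β E M c g hC hη (by omega) hMη hg₁ hg₂) ?_ hf2 hρ W
  intro x k hk
  refine hf1 x k fun x' => ?_
  simp only [hB, Fintype.mem_piFinset, Finset.mem_Ico]
  intro i
  have h1 := (Finset.mem_filter.1 hk).2 i
  have h2 := hcN x i
  have h3 := typeCount_le x i
  have h4 := typeCount_le x' i
  simp only [Pi.sub_apply, Pi.add_apply, typeVec]
  omega

end Protocol

/-! ### Block-preserving diagonalisation -/

section Diagonalization

open Matrix in
/-- A Hermitian matrix that is block diagonal with respect to the labels `c` is diagonalised by a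
unitary matrix that is block diagonal as well. -/
theorem exists_unitary_diagonalizing_of_block {X ι : Type*} [Fintype X] [DecidableEq X]
    [Fintype ι] [DecidableEq ι] (c : X → ι) {A : Matrix X X ℂ} (hA : A.IsHermitian)
    (hc : ∀ x y, A x y ≠ 0 → c x = c y) :
    ∃ (V : Matrix X X ℂ) (l : X → ℝ), V ∈ unitaryGroup X ℂ ∧
      (∀ x y, V x y ≠ 0 → c x = c y) ∧ Vᴴ * A * V = diagonal (fun x => (l x : ℂ)) := by
  let Ak : ∀ k : ι, Matrix {x // c x = k} {x // c x = k} ℂ := fun k =>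
    A.submatrix Subtype.val Subtype.val
  have hAk : ∀ k, (Ak k).IsHermitian := fun k => hA.submatrix _
  let Vk : ∀ k : ι, Matrix {x // c x = k} {x // c x = k} ℂ := fun k => (hAk k).eigenvectorUnitary
  let e : X ≃ Σ k : ι, {x // c x = k} := (Equiv.sigmaFiberEquiv c).symm
  have he : ∀ x, e x = ⟨c x, ⟨x, rfl⟩⟩ := fun x => rfl
  have hAe : A = (blockDiagonal' Ak).submatrix e e := by
    ext x y
    rw [submatrix_apply, he, he, blockDiagonal'_apply]
    by_cases h : c x = c y
    · rw [dif_pos h]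
      have : (cast (congrArg (fun k => {x // c x = k}) h.symm) (⟨y, rfl⟩ : {x // c x = c y})) =
          (⟨y, h.symm⟩ : {z // c z = c x}) := by
        rw [cast_eq_iff_heq]
        congr 1
        · rw [h]
        · exact proof_irrel_heq _ _
      simp only
      rw [this]
      rfl
    · rw [dif_neg h]
      by_contra h0
      exact h (hc x y h0)
  refine ⟨(blockDiagonal' Vk).submatrix e e, fun x => (hAk (c x)).eigenvalues ⟨x, rfl⟩, ?_, ?_, ?_⟩
  · rw [mem_unitaryGroup_iff', star_eq_conjTranspose, conjTranspose_submatrix, submatrix_mul_equiv,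
      blockDiagonal'_conjTranspose, ← blockDiagonal'_mul]
    have : (fun k => (Vk k)ᴴ * Vk k) = 1 := by
      funext k
      exact mem_unitaryGroup_iff'.1 (hAk k).eigenvectorUnitary.2
    rw [this, blockDiagonal'_one]
    simp
  · intro x y h
    by_contra hne
    rw [submatrix_apply, he, he, blockDiagonal'_apply_ne _ _ _ hne] at h
    exact h rfl
  · conv_lhs => rw [hAe]
    rw [conjTranspose_submatrix, submatrix_mul_equiv, submatrix_mul_equiv,
      blockDiagonal'_conjTranspose, ← blockDiagonal'_mul, ← blockDiagonal'_mul]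
    have : (fun k => (Vk k)ᴴ * Ak k * Vk k) =
        fun k => diagonal (fun i => ((hAk k).eigenvalues i : ℂ)) := by
      funext k
      have := (hAk k).conjStarAlgAut_star_eigenvectorUnitary
      rw [Unitary.conjStarAlgAut_star_apply] at this
      exact this
    rw [this, blockDiagonal'_diagonal]
    ext x y
    simp only [submatrix_apply, diagonal_apply, e.injective.eq_iff]
    rfl

end Diagonalization

/-! ### A universal dominating operator from joint types -/

section Universal

variable {d n : ℕ}

/-- The type of a sequence of length `n`, with values in a finite type. -/
def typeFin {α : Type*} [DecidableEq α] (z : Fin n → α) (a : α) : Fin (n + 1) :=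
  ⟨typeCount z a, Nat.lt_succ_of_le (typeCount_le z a)⟩

/-- The joint type of two sequences. -/
def jointType (x y : Fin n → Fin d) : Fin d × Fin d → Fin (n + 1) :=
  typeFin fun i => (x i, y i)

/-- The number of sequences of a given type. -/
def typeClassCard {α : Type*} [Fintype α] [DecidableEq α] (T : α → Fin (n + 1)) : ℕ :=
  (Finset.univ.filter fun z : Fin n → α => typeFin z = T).card

theorem prod_eq_prod_pow_typeFin {α R : Type*} [Fintype α] [DecidableEq α] [CommMonoid R]
    (f : α → R) (z : Fin n → α) : ∏ i, f (z i) = ∏ a, f a ^ (typeFin z a : ℕ) := by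
  rw [← Finset.prod_fiberwise (s := Finset.univ) (g := z) (f := fun j => f (z j))]
  refine Finset.prod_congr rfl fun a _ => ?_
  rw [Finset.prod_congr rfl (g := fun _ => f a) (by
    intro j hj; rw [(Finset.mem_filter.1 hj).2])]
  simp [typeFin, typeCount]

/-- The type of the first sequence is a marginal of the joint type. -/
theorem typeCount_eq_of_jointType_eq {x z y : Fin n → Fin d}
    (h : jointType x y = jointType z y) : typeCount x = typeCount z := by
  have key : ∀ u : Fin n → Fin d, ∀ a, typeCount u a = ∑ b, (jointType u y (a, b) : ℕ) := by
    intro u a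
    simp only [jointType, typeFin, typeCount]
    rw [Finset.card_eq_sum_card_fiberwise (f := y) (t := Finset.univ) (fun _ _ => by simp)]
    refine Finset.sum_congr rfl fun b _ => ?_
    congr 1
    ext i
    simp
  funext a
  rw [key x, key z, h]

/-- The matrix `A` such that `A Aᴴ` dominates all states `ρ^{⊗ n}` up to a polynomial factor. -/
noncomputable def universalFactor (d n : ℕ) :
    Matrix (Fin n → Fin d) ((Fin n → Fin d) × (Fin d × Fin d → Fin (n + 1))) ℂ :=
  fun x q => if jointType x q.1 = q.2 then ((Real.sqrt (typeClassCard q.2))⁻¹ : ℝ) else 0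

theorem universalFactor_block {x x' : Fin n → Fin d}
    (h : (universalFactor d n * (universalFactor d n).conjTranspose) x x' ≠ 0) :
    typeCount x = typeCount x' := by
  rw [Matrix.mul_apply] at h
  obtain ⟨q, _, hq⟩ := Finset.exists_ne_zero_of_sum_ne_zero h
  rw [Matrix.conjTranspose_apply] at hq
  by_cases h1 : jointType x q.1 = q.2
  · by_cases h2 : jointType x' q.1 = q.2
    · exact typeCount_eq_of_jointType_eq (h1.trans h2.symm)
    · simp [universalFactor, h2] at hq
  · simp [universalFactor, h1] at hq

/-- Each joint type T contributes |T| pairs of weight 1/|T|, so at most 1 (an empty class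
contributes 0), and there are (n+1)^{d²} candidates for T. -/
theorem sum_norm_sq_universalFactor_le (d n : ℕ) :
    ∑ x, ∑ q, ‖universalFactor d n x q‖ ^ 2 ≤ ((n : ℝ) + 1) ^ (d * d) := by
  have h1 : ∀ x q, ‖universalFactor d n x q‖ ^ 2 =
      if jointType x q.1 = q.2 then ((typeClassCard q.2 : ℝ))⁻¹ else 0 := by
    intro x q
    unfold universalFactor
    split_ifs
    · rw [Complex.norm_real, Real.norm_eq_abs, sq_abs, inv_pow, Real.sq_sqrt (Nat.cast_nonneg _)]
    · simp
  calc ∑ x, ∑ q, ‖universalFactor d n x q‖ ^ 2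
      = ∑ T : Fin d × Fin d → Fin (n + 1), ∑ z : Fin n → Fin d × Fin d,
          if typeFin z = T then ((typeClassCard T : ℝ))⁻¹ else 0 := by
        simp only [h1, Fintype.sum_prod_type]
        rw [Finset.sum_congr rfl fun x _ => Finset.sum_comm, Finset.sum_comm]
        refine Finset.sum_congr rfl fun T _ => ?_
        rw [← Fintype.sum_prod_type']
        exact Fintype.sum_equiv (Equiv.arrowProdEquivProdArrow _ _ _).symm _ _ fun p => rfl
    _ ≤ ∑ T : Fin d × Fin d → Fin (n + 1), 1 := by
        refine Finset.sum_le_sum fun T _ => ?_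
        rw [← Finset.sum_filter, Finset.sum_const, nsmul_eq_mul]
        exact mul_inv_le_one
    _ = _ := by simp

/-- The numbers |B a b|² form a probability distribution on pairs; its n-th power gives the same
probability to each member of the class T, and the class has probability at most 1. -/
theorem typeClassCard_mul_norm_sq_le (B : Matrix (Fin d) (Fin d) ℂ)
    (hB : ∑ a, ∑ b, ‖B a b‖ ^ 2 = 1) (T : Fin d × Fin d → Fin (n + 1)) :
    (typeClassCard T : ℝ) * ‖∏ p : Fin d × Fin d, B p.1 p.2 ^ (T p : ℕ)‖ ^ 2 ≤ 1 := by
  have h1 : ∑ z : Fin n → Fin d × Fin d, ∏ i, ‖B (z i).1 (z i).2‖ ^ 2 = 1 := by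
    rw [← Fintype.sum_pow (fun p : Fin d × Fin d => ‖B p.1 p.2‖ ^ 2), Fintype.sum_prod_type, hB,
      one_pow]
  rw [← h1, typeClassCard, ← nsmul_eq_mul, ← Finset.sum_const]
  refine (Finset.sum_le_sum fun z hz => le_of_eq ?_).trans
    (Finset.sum_le_sum_of_subset_of_nonneg (Finset.filter_subset _ _) fun z _ _ => by positivity)
  rw [← (Finset.mem_filter.1 hz).2,
    ← prod_eq_prod_pow_typeFin (fun p : Fin d × Fin d => B p.1 p.2) z, norm_prod, Finset.prod_pow]

/-- Every column of `B^{⊗ n}` is dominated by the universal factor. -/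
theorem norm_sq_tensorPower_le (B : Matrix (Fin d) (Fin d) ℂ) (hB : ∑ a, ∑ b, ‖B a b‖ ^ 2 = 1)
    (φ : (Fin n → Fin d) → ℂ) (j : Fin n → Fin d) :
    ‖∑ x, φ x * tensorPower B n x j‖ ^ 2 ≤
      ((n : ℝ) + 1) ^ (d * d) * ∑ q, ‖∑ x, φ x * universalFactor d n x q‖ ^ 2 := by
  set b : (Fin d × Fin d → Fin (n + 1)) → ℂ :=
    fun T => ∏ p : Fin d × Fin d, B p.1 p.2 ^ (T p : ℕ) with hb
  set s : (Fin d × Fin d → Fin (n + 1)) → ℂ :=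
    fun T => ∑ x, if jointType x j = T then φ x else 0 with hs
  have h1 : ∑ x, φ x * tensorPower B n x j = ∑ T, b T * s T := by
    simp only [hs, Finset.mul_sum]
    rw [Finset.sum_comm]
    refine Finset.sum_congr rfl fun x _ => ?_
    simp only [mul_ite, mul_zero, Finset.sum_ite_eq, Finset.mem_univ, if_true]
    rw [mul_comm]
    congr 1
    exact prod_eq_prod_pow_typeFin (fun p : Fin d × Fin d => B p.1 p.2) (fun i => (x i, j i))
  have h2 : ∀ T, ∑ x, φ x * universalFactor d n x (j, T) =
      s T * ((Real.sqrt (typeClassCard T))⁻¹ : ℝ) := by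
    intro T
    simp only [hs, Finset.sum_mul, universalFactor]
    refine Finset.sum_congr rfl fun x _ => ?_
    split_ifs <;> simp
  have h3 : ∀ T, ‖b T * s T‖ ^ 2 ≤ ‖∑ x, φ x * universalFactor d n x (j, T)‖ ^ 2 := by
    intro T
    rw [h2, norm_mul, norm_mul, mul_pow, mul_pow, mul_comm, Complex.norm_real, Real.norm_eq_abs,
      sq_abs, inv_pow, Real.sq_sqrt (Nat.cast_nonneg _)]
    -- For an empty class the inverse on the right is the default value 0, but then no x has joint
    -- type T with j and s T vanishes too.
    rcases Nat.eq_zero_or_pos (typeClassCard T) with h0 | h0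
    · have : s T = 0 := by
        refine Finset.sum_eq_zero fun x _ => if_neg fun hx => ?_
        have := Finset.card_eq_zero.1 h0
        exact Finset.notMem_empty _ (this ▸ Finset.mem_filter.2 ⟨Finset.mem_univ
          (fun i => (x i, j i)), hx⟩)
      simp [this]
    · refine mul_le_mul_of_nonneg_left ?_ (sq_nonneg _)
      have h0' : (0 : ℝ) < typeClassCard T := by exact_mod_cast h0
      rw [← one_div, le_div_iff₀ h0', mul_comm]
      exact typeClassCard_mul_norm_sq_le B hB T
  calc ‖∑ x, φ x * tensorPower B n x j‖ ^ 2
      ≤ (∑ T, ‖b T * s T‖) ^ 2 := by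
        rw [h1]
        exact pow_le_pow_left₀ (norm_nonneg _) (norm_sum_le _ _) 2
    -- Cauchy–Schwarz over the joint types is the only loss, and it is polynomial in n.
    _ ≤ (Finset.univ : Finset (Fin d × Fin d → Fin (n + 1))).card * ∑ T, ‖b T * s T‖ ^ 2 :=
        sq_sum_le_card_mul_sum_sq
    _ = ((n : ℝ) + 1) ^ (d * d) * ∑ T, ‖b T * s T‖ ^ 2 := by simp
    _ ≤ ((n : ℝ) + 1) ^ (d * d) * ∑ T, ‖∑ x, φ x * universalFactor d n x (j, T)‖ ^ 2 := by
        exact mul_le_mul_of_nonneg_left (Finset.sum_le_sum fun T _ => h3 T) (by positivity)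
    _ ≤ _ := by
        gcongr
        rw [Fintype.sum_prod_type]
        exact Finset.single_le_sum
          (f := fun y => ∑ T, ‖∑ x, φ x * universalFactor d n x (y, T)‖ ^ 2)
          (fun y _ => by positivity) (Finset.mem_univ j)

end Universal

/-! ### The universal basis and its weights -/

section UniversalBasis

variable {d n : ℕ}

/-- The rows of G are orthogonal with squared norms l x, so this is Pythagoras. -/
theorem sum_norm_sq_of_mul_conjTranspose_eq_diagonal {X Q : Type*} [Fintype X] [DecidableEq X]
    [Fintype Q] {G : Matrix X Q ℂ} {l : X → ℝ}
    (hG : G * G.conjTranspose = Matrix.diagonal fun x => (l x : ℂ)) (S : Finset X) (a : X → ℂ) :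
    ∑ q, ‖∑ x ∈ S, a x * G x q‖ ^ 2 = ∑ x ∈ S, l x * ‖a x‖ ^ 2 := by
  have h : ((∑ q, ‖∑ x ∈ S, a x * G x q‖ ^ 2 : ℝ) : ℂ) = ((∑ x ∈ S, l x * ‖a x‖ ^ 2 : ℝ) : ℂ) := by
    push_cast
    simp only [← Complex.mul_conj', map_sum, map_mul]
    calc ∑ q, (∑ x ∈ S, a x * G x q) * ∑ y ∈ S, (starRingEnd ℂ) (a y) * (starRingEnd ℂ) (G y q)
        = ∑ x ∈ S, ∑ y ∈ S, a x * (starRingEnd ℂ) (a y) * (G * G.conjTranspose) x y := by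
          simp only [Finset.sum_mul_sum]
          rw [Finset.sum_comm]
          refine Finset.sum_congr rfl fun x _ => ?_
          rw [Finset.sum_comm]
          refine Finset.sum_congr rfl fun y _ => ?_
          rw [Matrix.mul_apply, Finset.mul_sum]
          refine Finset.sum_congr rfl fun q _ => ?_
          rw [Matrix.conjTranspose_apply, starRingEnd_apply, starRingEnd_apply]
          ring
      _ = _ := by
          rw [hG]
          refine Finset.sum_congr rfl fun x hx => ?_
          simp only [Matrix.diagonal_apply, mul_ite, mul_zero, Finset.sum_ite_eq, hx, if_true]
          ring
  exact_mod_cast h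

/-- A basis of type-homogeneous vectors (the rows of `U`) with weights `l` of polynomial total mass
that dominate all the states `(B Bᴴ)^{⊗ n}`. -/
structure IsUniversalBasis (U : Matrix (Fin n → Fin d) (Fin n → Fin d) ℂ)
    (l : (Fin n → Fin d) → ℝ) : Prop where
  unitary : U ∈ Matrix.unitaryGroup (Fin n → Fin d) ℂ
  block : ∀ x y, U x y ≠ 0 → typeCount x = typeCount y
  nonneg : ∀ x, 0 ≤ l x
  sum_le : ∑ x, l x ≤ ((n : ℝ) + 1) ^ (d * d)
  dominates : ∀ B : Matrix (Fin d) (Fin d) ℂ, ∑ a, ∑ b, ‖B a b‖ ^ 2 = 1 →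
    ∀ j (S : Finset (Fin n → Fin d)), (∑ x ∈ S, ‖(U * tensorPower B n) x j‖ ^ 2) ^ 2 ≤
      ((n : ℝ) + 1) ^ (d * d) * ∑ x ∈ S, l x * ‖(U * tensorPower B n) x j‖ ^ 2

/-- The basis diagonalises F Fᴴ inside each type class. The trace gives the total mass of the
weights, and domination comes from testing `norm_sq_tensorPower_le` on a suitable vector. -/
theorem exists_isUniversalBasis (d n : ℕ) :
    ∃ (U : Matrix (Fin n → Fin d) (Fin n → Fin d) ℂ) (l : (Fin n → Fin d) → ℝ),
      IsUniversalBasis U l := by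
  set F := universalFactor d n with hF
  obtain ⟨V, l, hV, hVb, hVl⟩ := exists_unitary_diagonalizing_of_block
    (fun x : Fin n → Fin d => typeFin x) (A := F * F.conjTranspose)
    (Matrix.isHermitian_mul_conjTranspose_self F) (by
      intro x y h
      have := universalFactor_block h
      funext a
      simp [typeFin, this])
  set G := V.conjTranspose * F with hG
  have hGG : G * G.conjTranspose = Matrix.diagonal fun x => (l x : ℂ) := by
    rw [← hVl, hG, Matrix.conjTranspose_mul, Matrix.conjTranspose_conjTranspose]
    simp only [Matrix.mul_assoc]
  have hl : ∀ x, l x = ∑ q, ‖G x q‖ ^ 2 := by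
    intro x
    have := sum_norm_sq_of_mul_conjTranspose_eq_diagonal hGG {x} (fun _ => 1)
    simpa using this.symm
  refine ⟨V.conjTranspose, l, ?_, ?_, ?_, ?_, ?_⟩
  · exact Unitary.star_mem hV
  · intro x y h
    rw [Matrix.conjTranspose_apply] at h
    have h2 := hVb y x (by simpa using h)
    funext a
    have h3 := congrArg Fin.val (congrFun h2 a)
    exact h3.symm
  · intro x
    rw [hl]
    positivity
  · have h1 : ((∑ x, l x : ℝ) : ℂ) = ((∑ x, ∑ q, ‖F x q‖ ^ 2 : ℝ) : ℂ) := by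
      have h2 : ((∑ x, l x : ℝ) : ℂ) = Matrix.trace (Matrix.diagonal fun x => (l x : ℂ)) := by
        simp [Matrix.trace_diagonal]
      rw [h2, ← hVl, Matrix.trace_mul_comm, ← Matrix.mul_assoc]
      have h3 : V * V.conjTranspose = 1 := Matrix.mem_unitaryGroup_iff.1 hV
      rw [h3, Matrix.one_mul, Matrix.trace]
      push_cast
      refine Finset.sum_congr rfl fun x _ => ?_
      rw [Matrix.diag_apply, Matrix.mul_apply]
      refine Finset.sum_congr rfl fun q _ => ?_
      rw [Matrix.conjTranspose_apply, ← Complex.mul_conj', starRingEnd_apply]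
    have h4 : ∑ x, l x = ∑ x, ∑ q, ‖F x q‖ ^ 2 := by exact_mod_cast h1
    rw [h4]
    exact sum_norm_sq_universalFactor_le d n
  · intro B hB j S
    set u := fun x => (V.conjTranspose * tensorPower B n) x j with hu
    have h1 : ∀ {Q : Type} (C : Matrix (Fin n → Fin d) Q ℂ) (q : Q),
        ∑ y, (∑ x ∈ S, star (u x) * V.conjTranspose x y) * C y q =
          ∑ x ∈ S, star (u x) * (V.conjTranspose * C) x q := by
      intro Q C q
      simp only [Finset.sum_mul, Matrix.mul_apply, Finset.mul_sum]
      rw [Finset.sum_comm]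
      simp only [mul_assoc]
    -- The test functional is paired with the projection of column j onto the basis vectors in S: on
    -- the column itself it gives ∑_S |u x|², and on F it gives ∑_S l x |u x|² by Pythagoras.
    have h2 := norm_sq_tensorPower_le B hB (fun y => ∑ x ∈ S, star (u x) * V.conjTranspose x y) j
    simp only [h1] at h2
    rw [sum_norm_sq_of_mul_conjTranspose_eq_diagonal hGG] at h2
    have h3 : ∑ x ∈ S, star (u x) * (V.conjTranspose * tensorPower B n) x j =
        ((∑ x ∈ S, ‖u x‖ ^ 2 : ℝ) : ℂ) := by
      push_cast
      refine Finset.sum_congr rfl fun x _ => ?_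
      rw [← Complex.conj_mul', starRingEnd_apply]
    rw [h3, Complex.norm_real, Real.norm_eq_abs, sq_abs] at h2
    simpa only [norm_star] using h2

end UniversalBasis

/-! ### Comparison of weights with eigenvalues, and the law of large numbers -/

section Concentration

/-- Weights `l` that dominate a state are not much smaller than its typical eigenvalues. -/
theorem sum_weight_le_of_small {X J : Type*} [Fintype X] [Fintype J] (p : J → ℝ)
    (c : X → J → ℝ) (l : X → ℝ) (v : ℝ) (hp : ∀ j, 0 ≤ p j) (hp1 : ∑ j, p j = 1)
    (hc : ∀ x j, 0 ≤ c x j) (hcol : ∀ j, ∑ x, c x j = 1) (hv : 0 ≤ v)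
    (hdom : ∀ j (S : Finset X),
      (∑ x ∈ S, p j * c x j) ^ 2 ≤ v * ∑ x ∈ S, l x * (p j * c x j))
    {s t : ℝ} (hs : 0 ≤ s) (ht : 0 < t) (S : Finset X) (hS : ∀ x ∈ S, l x ≤ s) :
    ∑ x ∈ S, ∑ j, p j * c x j ≤ (∑ j, if p j < t then p j else 0) + v * s / t := by
  classical
  have hpc : ∀ x j, 0 ≤ p j * c x j := fun x j => mul_nonneg (hp j) (hc x j)
  have h1 : ∀ j, ∑ x ∈ S, p j * c x j ≤ p j := by
    intro j
    calc ∑ x ∈ S, p j * c x j ≤ ∑ x, p j * c x j :=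
          Finset.sum_le_sum_of_subset_of_nonneg (Finset.subset_univ _) fun x _ _ => hpc x j
      _ = p j := by rw [← Finset.mul_sum, hcol, mul_one]
  -- Domination bounds the square of the captured mass a by v s a, so one factor a cancels.
  have h2 : ∀ j, ∑ x ∈ S, p j * c x j ≤ v * s := by
    intro j
    set a := ∑ x ∈ S, p j * c x j with ha
    have ha0 : 0 ≤ a := Finset.sum_nonneg fun x _ => hpc x j
    have h3 : a ^ 2 ≤ v * s * a := by
      refine (hdom j S).trans ?_
      rw [mul_assoc, ha, Finset.mul_sum (a := s)]
      exact mul_le_mul_of_nonneg_left (Finset.sum_le_sum fun x hx =>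
        mul_le_mul_of_nonneg_right (hS x hx) (hpc x j)) hv
    rcases ha0.eq_or_lt with h0 | h0
    · rw [← h0]; positivity
    · rw [pow_two] at h3
      exact le_of_mul_le_mul_right h3 h0
  -- Eigenvalues below t are charged in full; for p j ≥ t the bound v s is at most the fraction v s
  -- / t of p j, and these fractions sum to v s / t.
  have h4 : ∀ j, ∑ x ∈ S, p j * c x j ≤ (if p j < t then p j else 0) + v * s / t * p j := by
    intro j
    split_ifs with h
    · have : 0 ≤ v * s / t * p j := mul_nonneg (by positivity) (hp j)
      linarith [h1 j]
    · push Not at h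
      have h5 : v * s ≤ v * s / t * p j := by
        rw [div_mul_eq_mul_div, le_div_iff₀ ht]
        exact mul_le_mul_of_nonneg_left h (by positivity)
      linarith [h2 j]
  rw [Finset.sum_comm]
  calc _ ≤ ∑ j, ((if p j < t then p j else 0) + v * s / t * p j) :=
        Finset.sum_le_sum fun j _ => h4 j
    _ = _ := by rw [Finset.sum_add_distrib, ← Finset.mul_sum, hp1, mul_one]

/-- Weights `l` of bounded total mass are not much larger than the typical eigenvalues of a
state. -/
theorem sum_weight_le_of_large {X J : Type*} [Fintype X] [Fintype J] (p : J → ℝ)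
    (c : X → J → ℝ) (l : X → ℝ) (v : ℝ) (hp : ∀ j, 0 ≤ p j)
    (hc : ∀ x j, 0 ≤ c x j) (hcol : ∀ j, ∑ x, c x j = 1) (hrow : ∀ x, ∑ j, c x j = 1)
    (hl : ∀ x, 0 ≤ l x) (hlv : ∑ x, l x ≤ v) {s t : ℝ} (hs : 0 < s) (ht : 0 ≤ t)
    (S : Finset X) (hS : ∀ x ∈ S, s ≤ l x) :
    ∑ x ∈ S, ∑ j, p j * c x j ≤ (∑ j, if t < p j then p j else 0) + t * v / s := by
  classical
  have hcard : (S.card : ℝ) ≤ v / s := by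
    rw [le_div_iff₀ hs]
    calc (S.card : ℝ) * s = ∑ _x ∈ S, s := by simp
      _ ≤ ∑ x ∈ S, l x := Finset.sum_le_sum hS
      _ ≤ ∑ x, l x := Finset.sum_le_sum_of_subset_of_nonneg (Finset.subset_univ _)
          fun x _ _ => hl x
      _ ≤ v := hlv
  -- Eigenvalues above t are charged in full; the others contribute at most t per basis vector, and
  -- S has at most v / s elements.
  have h1 : ∀ x j, p j * c x j ≤ (if t < p j then p j else 0) * c x j + t * c x j := by
    intro x j
    split_ifs with h
    · have := mul_nonneg ht (hc x j)
      linarith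
    · push Not at h
      have := mul_le_mul_of_nonneg_right h (hc x j)
      linarith
  calc ∑ x ∈ S, ∑ j, p j * c x j
      ≤ ∑ x ∈ S, ∑ j, ((if t < p j then p j else 0) * c x j + t * c x j) :=
        Finset.sum_le_sum fun x _ => Finset.sum_le_sum fun j _ => h1 x j
    _ = ∑ x ∈ S, ∑ j, (if t < p j then p j else 0) * c x j + S.card * t := by
        simp only [Finset.sum_add_distrib, ← Finset.mul_sum, hrow, mul_one, Finset.sum_const,
          nsmul_eq_mul]
    _ ≤ ∑ x, ∑ j, (if t < p j then p j else 0) * c x j + v / s * t := by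
        refine add_le_add ?_ (mul_le_mul_of_nonneg_right hcard ht)
        refine Finset.sum_le_sum_of_subset_of_nonneg (Finset.subset_univ _) fun x _ _ =>
          Finset.sum_nonneg fun j _ => mul_nonneg ?_ (hc x j)
        split_ifs
        · exact hp j
        · exact le_rfl
    _ = _ := by
        rw [Finset.sum_comm]
        simp only [← Finset.mul_sum, hcol, mul_one]
        ring

theorem sum_pi_prod {ι : Type*} [Fintype ι] {n : ℕ} (F : Fin n → ι → ℝ) :
    ∑ x : Fin n → ι, ∏ k, F k (x k) = ∏ k, ∑ a, F k a := by
  classical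
  rw [Finset.prod_univ_sum, Fintype.piFinset_univ]

/-- By independence the cross terms of centred variables vanish. -/
theorem sum_prod_mul_sum_sq {ι : Type*} [Fintype ι] {n : ℕ} (r g : ι → ℝ) (hr : ∑ a, r a = 1)
    (hg : ∑ a, r a * g a = 0) :
    ∑ x : Fin n → ι, (∏ k, r (x k)) * (∑ k, g (x k)) ^ 2 = n * ∑ a, r a * g a ^ 2 := by
  have h : ∀ i j : Fin n, ∑ x : Fin n → ι, (∏ k, r (x k)) * (g (x i) * g (x j)) =
      if i = j then ∑ a, r a * g a ^ 2 else 0 := by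
    intro i j
    have h1 : ∀ x : Fin n → ι, (∏ k, r (x k)) * (g (x i) * g (x j)) =
        ∏ k, (r (x k) * ((if k = i then g (x k) else 1) * (if k = j then g (x k) else 1))) := by
      intro x
      rw [Finset.prod_mul_distrib, Finset.prod_mul_distrib]
      simp
    simp only [h1]
    rw [sum_pi_prod fun k a => r a * ((if k = i then g a else 1) * (if k = j then g a else 1))]
    split_ifs with hij
    · subst hij
      rw [Finset.prod_eq_single i]
      · simp [pow_two]
      · intro k _ hk
        simp [hk, hr]
      · simp
    · refine Finset.prod_eq_zero (Finset.mem_univ i) ?_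
      simpa [hij] using hg
  calc ∑ x : Fin n → ι, (∏ k, r (x k)) * (∑ k, g (x k)) ^ 2
      = ∑ x : Fin n → ι, ∑ i, ∑ j, (∏ k, r (x k)) * (g (x i) * g (x j)) := by
        refine Finset.sum_congr rfl fun x _ => ?_
        rw [pow_two, Finset.sum_mul_sum, Finset.mul_sum]
        exact Finset.sum_congr rfl fun i _ => Finset.mul_sum _ _ _
    _ = ∑ i : Fin n, ∑ j : Fin n, ∑ x : Fin n → ι, (∏ k, r (x k)) * (g (x i) * g (x j)) := by
        rw [Finset.sum_comm]
        exact Finset.sum_congr rfl fun i _ => Finset.sum_comm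
    _ = _ := by simp [h]

/-- The weak law of large numbers for a product distribution on sequences. -/
theorem sum_prod_deviation_le {ι : Type*} [Fintype ι] {n : ℕ} (r f : ι → ℝ)
    (hr0 : ∀ a, 0 ≤ r a) (hr : ∑ a, r a = 1) {t : ℝ} (ht : 0 < t) :
    (∑ x : Fin n → ι, if t ≤ |∑ k, f (x k) - n * ∑ a, r a * f a| then ∏ k, r (x k) else 0) ≤
      n * (∑ a, r a * (f a - ∑ b, r b * f b) ^ 2) / t ^ 2 := by
  set μ := ∑ a, r a * f a with hμ
  have h0 : ∑ a, r a * (f a - μ) = 0 := by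
    simp only [mul_sub, Finset.sum_sub_distrib, ← Finset.sum_mul, hr, one_mul]
    rw [hμ, sub_self]
  rw [← sum_prod_mul_sum_sq (n := n) r (fun a => f a - μ) hr h0, Finset.sum_div]
  refine Finset.sum_le_sum fun x _ => ?_
  have hP : 0 ≤ ∏ k, r (x k) := Finset.prod_nonneg fun k _ => hr0 _
  have hs : ∑ k, (f (x k) - μ) = ∑ k, f (x k) - n * μ := by simp [Finset.sum_sub_distrib]
  rw [hs]
  split_ifs with h
  · rw [le_div_iff₀ (by positivity)]
    refine mul_le_mul_of_nonneg_left ?_ hP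
    rw [← sq_abs (_ - _)]
    exact pow_le_pow_left₀ ht.le h 2
  · positivity

end Concentration

/-! ### Tensor powers of matrices -/

section TensorPower

variable {d n : ℕ}

theorem tensorPower_mul (A B : Matrix (Fin d) (Fin d) ℂ) :
    tensorPower (A * B) n = tensorPower A n * tensorPower B n := by
  ext x y
  simp only [tensorPower, Matrix.mul_apply]
  rw [Finset.prod_univ_sum, Fintype.piFinset_univ]
  simp only [Finset.prod_mul_distrib]

theorem tensorPower_conjTranspose (A : Matrix (Fin d) (Fin d) ℂ) :
    tensorPower A.conjTranspose n = (tensorPower A n).conjTranspose := by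
  ext x y
  simp [tensorPower, Matrix.conjTranspose_apply, star_prod]

theorem tensorPower_diagonal (a : Fin d → ℂ) :
    tensorPower (Matrix.diagonal a) n = Matrix.diagonal fun x : Fin n → Fin d => ∏ i, a (x i) := by
  ext x y
  simp only [tensorPower, Matrix.diagonal_apply]
  split_ifs with h
  · subst h; simp
  · obtain ⟨i, hi⟩ := Function.ne_iff.1 h
    exact Finset.prod_eq_zero (Finset.mem_univ i) (if_neg hi)

theorem tensorPower_mem_unitaryGroup {V : Matrix (Fin d) (Fin d) ℂ}
    (hV : V ∈ Matrix.unitaryGroup (Fin d) ℂ) :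
    tensorPower V n ∈ Matrix.unitaryGroup (Fin n → Fin d) ℂ := by
  rw [Matrix.mem_unitaryGroup_iff, Matrix.star_eq_conjTranspose, ← tensorPower_conjTranspose,
    ← tensorPower_mul, ← Matrix.star_eq_conjTranspose, Matrix.mem_unitaryGroup_iff.1 hV,
    ← Matrix.diagonal_one, tensorPower_diagonal]
  simp

end TensorPower

/-! ### Spectral decomposition and functional calculus -/

section Spectral

open Matrix

variable {d : ℕ}

theorem eq_mul_diagonal_mul {A : Matrix (Fin d) (Fin d) ℂ} (hA : A.IsHermitian) :
    A = (hA.eigenvectorUnitary : Matrix (Fin d) (Fin d) ℂ) *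
      diagonal (fun i => (hA.eigenvalues i : ℂ)) *
      (hA.eigenvectorUnitary : Matrix (Fin d) (Fin d) ℂ)ᴴ := by
  conv_lhs => rw [hA.spectral_theorem, Unitary.conjStarAlgAut_apply]
  rfl

theorem cfc_eq_mul_diagonal_mul {A : Matrix (Fin d) (Fin d) ℂ} (hA : A.IsHermitian) (f : ℝ → ℝ) :
    cfc f A = (hA.eigenvectorUnitary : Matrix (Fin d) (Fin d) ℂ) *
      diagonal (fun i => (f (hA.eigenvalues i) : ℂ)) *
      (hA.eigenvectorUnitary : Matrix (Fin d) (Fin d) ℂ)ᴴ := by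
  rw [hA.cfc_eq, IsHermitian.cfc, Unitary.conjStarAlgAut_apply]
  rfl

/-- Comparing entries of D V = V Λ, a nonzero V i j forces g i to equal the j-th eigenvalue. Hence
f(D) V = V f(Λ) as well, with no need to match the two orderings of the spectrum. -/
theorem cfc_diagonal_real (f : ℝ → ℝ) (g : Fin d → ℝ) :
    cfc f (diagonal fun i => (g i : ℂ)) = diagonal fun i => (f (g i) : ℂ) := by
  have hA : (diagonal fun i => (g i : ℂ)).IsHermitian :=
    isHermitian_diagonal_of_self_adjoint _ (by ext i; simp)
  set V := (hA.eigenvectorUnitary : Matrix (Fin d) (Fin d) ℂ) with hV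
  have hVV : V * Vᴴ = 1 := mem_unitaryGroup_iff.1 hA.eigenvectorUnitary.2
  have hVV' : Vᴴ * V = 1 := mem_unitaryGroup_iff'.1 hA.eigenvectorUnitary.2
  have h1 : (diagonal fun i => (g i : ℂ)) * V =
      V * diagonal (fun i => (hA.eigenvalues i : ℂ)) := by
    conv_lhs => rw [eq_mul_diagonal_mul hA]
    rw [← hV, Matrix.mul_assoc, hVV', Matrix.mul_one]
  have h2 : (diagonal fun i => (f (g i) : ℂ)) * V =
      V * diagonal (fun i => (f (hA.eigenvalues i) : ℂ)) := by
    ext i j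
    have h3 := congrFun (congrFun h1 i) j
    rw [diagonal_mul, mul_diagonal] at h3 ⊢
    by_cases h0 : V i j = 0
    · simp [h0]
    · have h4 : (g i : ℂ) = hA.eigenvalues j := by
        rw [mul_comm] at h3
        exact mul_left_cancel₀ h0 h3
      have h5 : g i = hA.eigenvalues j := by exact_mod_cast h4
      rw [h5, mul_comm]
  rw [cfc_eq_mul_diagonal_mul hA, ← hV, ← h2, Matrix.mul_assoc, hVV, Matrix.mul_one]

end Spectral

/-! ### Relative entropy to the Gibbs state -/

section Entropy

open Matrix

variable {d : ℕ}

/-- The von Neumann entropy of a Hermitian matrix, from its eigenvalues. -/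
noncomputable def eigenEntropy {ρ : Matrix (Fin d) (Fin d) ℂ} (h : ρ.IsHermitian) : ℝ :=
  ∑ j, h.eigenvalues j * -Real.log (h.eigenvalues j)

/-- The mean energy. -/
noncomputable def meanEnergy (E : Fin d → ℝ) (ρ : Matrix (Fin d) (Fin d) ℂ) : ℝ :=
  ∑ i, (ρ i i).re * E i

theorem partitionFn_eq_sum (β : ℝ) (E : Fin d → ℝ) :
    partitionFn β E = ∑ i, Real.exp (-β * E i) := tsum_fintype _

theorem partitionFn_pos [NeZero d] (β : ℝ) (E : Fin d → ℝ) : 0 < partitionFn β E := by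
  rw [partitionFn_eq_sum]
  exact Finset.sum_pos (fun _ _ => Real.exp_pos _) ⟨0, Finset.mem_univ _⟩

theorem IsDensity.sum_diag_re {ρ : Matrix (Fin d) (Fin d) ℂ} (hρ : IsDensity ρ) :
    ∑ i, (ρ i i).re = 1 := by
  have h := hρ.2.unique (hasSum_fintype fun i => ρ i i)
  have := congrArg Complex.re h
  simpa using this.symm

theorem IsDensity.diag_re_nonneg {ρ : Matrix (Fin d) (Fin d) ℂ} (hρ : IsDensity ρ) (i : Fin d) :
    0 ≤ (ρ i i).re := (Complex.le_def.1 (hρ.1.diag_nonneg (i := i))).1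

theorem IsDensity.diag_eq {ρ : Matrix (Fin d) (Fin d) ℂ} (hρ : IsDensity ρ) (i : Fin d) :
    ρ i i = ((ρ i i).re : ℂ) := by
  apply Complex.ext
  · simp
  · have := (Complex.le_def.1 (hρ.1.diag_nonneg (i := i))).2
    simpa using this.symm

theorem diag_re_eq_sum {ρ : Matrix (Fin d) (Fin d) ℂ} (h : ρ.IsHermitian) (i : Fin d) :
    (ρ i i).re = ∑ j, ‖(h.eigenvectorUnitary : Matrix (Fin d) (Fin d) ℂ) i j‖ ^ 2 *
      h.eigenvalues j := by
  set V := (h.eigenvectorUnitary : Matrix (Fin d) (Fin d) ℂ) with hV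
  have h1 : ρ i i = ((∑ j, ‖V i j‖ ^ 2 * h.eigenvalues j : ℝ) : ℂ) := by
    conv_lhs => rw [eq_mul_diagonal_mul h]
    rw [mul_apply]
    push_cast
    refine Finset.sum_congr rfl fun j _ => ?_
    rw [mul_diagonal, conjTranspose_apply, ← Complex.mul_conj', starRingEnd_apply]
    ring
  rw [h1, Complex.ofReal_re]

theorem sum_norm_sq_row {X : Type*} [Fintype X] [DecidableEq X] {V : Matrix X X ℂ}
    (hV : V ∈ unitaryGroup X ℂ) (i : X) : ∑ j, ‖V i j‖ ^ 2 = 1 := by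
  have h := unitary_row hV i i
  rw [if_pos rfl] at h
  have h1 : ((∑ j, ‖V i j‖ ^ 2 : ℝ) : ℂ) = 1 := by
    push_cast
    rw [← h]
    refine Finset.sum_congr rfl fun j _ => ?_
    rw [← Complex.mul_conj', starRingEnd_apply]
  exact_mod_cast h1

theorem sum_norm_sq_col {X : Type*} [Fintype X] [DecidableEq X] {V : Matrix X X ℂ}
    (hV : V ∈ unitaryGroup X ℂ) (j : X) : ∑ i, ‖V i j‖ ^ 2 = 1 := by
  have h := sum_norm_sq_row (Unitary.star_mem hV) j
  simpa [star_apply] using h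

theorem IsDensity.sum_eigenvalues {ρ : Matrix (Fin d) (Fin d) ℂ} (hρ : IsDensity ρ) :
    ∑ j, hρ.1.1.eigenvalues j = 1 := by
  rw [← hρ.sum_diag_re]
  simp only [diag_re_eq_sum hρ.1.1]
  rw [Finset.sum_comm]
  refine Finset.sum_congr rfl fun j _ => ?_
  rw [← Finset.sum_mul, sum_norm_sq_col hρ.1.1.eigenvectorUnitary.2, one_mul]

theorem log_gibbs_weight [NeZero d] (β : ℝ) (E : Fin d → ℝ) (i : Fin d) :
    Real.log (Real.exp (-β * E i) / partitionFn β E) =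
      -β * E i - Real.log (partitionFn β E) := by
  rw [Real.log_div (Real.exp_pos _).ne' (partitionFn_pos β E).ne', Real.log_exp]

theorem relEntropy_gibbs [NeZero d] (β : ℝ) (E : Fin d → ℝ) {ρ : Matrix (Fin d) (Fin d) ℂ}
    (hρ : IsDensity ρ) :
    relEntropy ρ (gibbs β E) =
      β * meanEnergy E ρ + Real.log (partitionFn β E) - eigenEntropy hρ.1.1 := by
  have hg : gibbs β E = diagonal fun i => ((Real.exp (-β * E i) / partitionFn β E : ℝ) : ℂ) := by
    ext i j
    simp [gibbs, diagonal_apply]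
  set V := (hρ.1.1.eigenvectorUnitary : Matrix (Fin d) (Fin d) ℂ) with hV
  have hVV' : Vᴴ * V = 1 := mem_unitaryGroup_iff'.1 hρ.1.1.eigenvectorUnitary.2
  have h1 : trace (ρ * cfc Real.log ρ) =
      ((∑ j, hρ.1.1.eigenvalues j * Real.log (hρ.1.1.eigenvalues j) : ℝ) : ℂ) := by
    refine (congrArg trace (congrArg₂ (· * ·) (eq_mul_diagonal_mul hρ.1.1)
      (cfc_eq_mul_diagonal_mul hρ.1.1 Real.log))).trans ?_
    rw [← hV, ← Matrix.mul_assoc, trace_mul_comm, ← Matrix.mul_assoc, ← Matrix.mul_assoc,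
      ← Matrix.mul_assoc, ← Matrix.mul_assoc, hVV', Matrix.one_mul,
      Matrix.mul_assoc (diagonal _), hVV',
      Matrix.mul_one, diagonal_mul_diagonal, trace_diagonal]
    push_cast
    rfl
  have h2 : trace (ρ * cfc Real.log (gibbs β E)) =
      ((∑ i, (ρ i i).re * (-β * E i - Real.log (partitionFn β E)) : ℝ) : ℂ) := by
    rw [hg, cfc_diagonal_real, trace]
    push_cast
    refine Finset.sum_congr rfl fun i _ => ?_
    rw [diag_apply, mul_diagonal, log_gibbs_weight, hρ.diag_eq i]
    push_cast
    simp
  rw [relEntropy, trace_sub, h1, h2, Complex.sub_re, Complex.ofReal_re, Complex.ofReal_re,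
    eigenEntropy, meanEnergy]
  simp only [mul_sub, Finset.sum_sub_distrib, ← Finset.sum_mul, hρ.sum_diag_re, mul_neg,
    Finset.sum_neg_distrib, Finset.mul_sum, one_mul]
  have : ∑ i, (ρ i i).re * (-β * E i) = - ∑ i, β * ((ρ i i).re * E i) := by
    rw [← Finset.sum_neg_distrib]
    exact Finset.sum_congr rfl fun i _ => by ring
  rw [this]
  ring

/-- Klein's inequality: p (log p - log g) ≥ p - g for each pair of an eigenvalue of ρ and a Gibbs
weight, averaged over the doubly stochastic matrix of squared overlaps. -/
theorem relEntropy_gibbs_nonneg [NeZero d] (β : ℝ) (E : Fin d → ℝ)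
    {ρ : Matrix (Fin d) (Fin d) ℂ} (hρ : IsDensity ρ) : 0 ≤ relEntropy ρ (gibbs β E) := by
  set p := hρ.1.1.eigenvalues with hp
  set c : Fin d → Fin d → ℝ := fun i j =>
    ‖(hρ.1.1.eigenvectorUnitary : Matrix (Fin d) (Fin d) ℂ) i j‖ ^ 2 with hc
  have hrow : ∀ i, ∑ j, c i j = 1 := sum_norm_sq_row hρ.1.1.eigenvectorUnitary.2
  have hcol : ∀ j, ∑ i, c i j = 1 := sum_norm_sq_col hρ.1.1.eigenvectorUnitary.2
  have hZ := partitionFn_pos β E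
  set g : Fin d → ℝ := fun i => Real.exp (-β * E i) / partitionFn β E with hg
  have hg0 : ∀ i, 0 < g i := fun i => div_pos (Real.exp_pos _) hZ
  have hg1 : ∑ i, g i = 1 := by
    rw [hg, ← Finset.sum_div, partitionFn_eq_sum]
    exact div_self (partitionFn_eq_sum β E ▸ hZ.ne')
  have hD : relEntropy ρ (gibbs β E) =
      ∑ i, ∑ j, c i j * (p j * (Real.log (p j) - Real.log (g i))) := by
    have h1 : ∑ i, ∑ j, c i j * (p j * Real.log (p j)) = - eigenEntropy hρ.1.1 := by
      rw [Finset.sum_comm, eigenEntropy, ← Finset.sum_neg_distrib]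
      refine Finset.sum_congr rfl fun j _ => ?_
      rw [← Finset.sum_mul, hcol]
      ring
    have h2 : ∑ i, ∑ j, c i j * (p j * Real.log (g i)) =
        - (β * meanEnergy E ρ) - Real.log (partitionFn β E) := by
      have h3 : ∀ i, ∑ j, c i j * (p j * Real.log (g i)) =
          - (β * ((ρ i i).re * E i)) - (ρ i i).re * Real.log (partitionFn β E) := by
        intro i
        rw [hg, log_gibbs_weight]
        simp only [← mul_assoc]
        rw [← Finset.sum_mul, diag_re_eq_sum hρ.1.1]
        ring
      simp only [h3, Finset.sum_sub_distrib, Finset.sum_neg_distrib, ← Finset.sum_mul,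
        hρ.sum_diag_re, one_mul, meanEnergy, Finset.mul_sum]
    simp only [mul_sub, Finset.sum_sub_distrib]
    rw [h1, h2, relEntropy_gibbs β E hρ]
    ring
  have hkl : ∀ i j, p j - g i ≤ p j * (Real.log (p j) - Real.log (g i)) := by
    intro i j
    rcases (hρ.1.eigenvalues_nonneg j).eq_or_lt with h | h
    · have h' : p j = 0 := h.symm
      rw [h']
      have := hg0 i
      simp only [zero_sub, zero_mul]
      linarith
    · have h1 := Real.log_le_sub_one_of_pos (div_pos (hg0 i) h)
      rw [Real.log_div (hg0 i).ne' h.ne'] at h1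
      have h2 := mul_le_mul_of_nonneg_left h1 h.le
      have h3 : hρ.1.1.eigenvalues j * (g i / hρ.1.1.eigenvalues j - 1) =
          g i - hρ.1.1.eigenvalues j := by
        field_simp
      rw [h3] at h2
      simp only [hp]
      linarith
  have h0 : ∑ i, ∑ j, c i j * (p j - g i) = 0 := by
    simp only [mul_sub, Finset.sum_sub_distrib]
    rw [Finset.sum_comm]
    simp only [← Finset.sum_mul, hrow, hcol, one_mul, hg1]
    rw [hp, hρ.sum_eigenvalues, sub_self]
  rw [hD, ← h0]
  refine Finset.sum_le_sum fun i _ => Finset.sum_le_sum fun j _ =>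
    mul_le_mul_of_nonneg_left (hkl i j) (by positivity)

end Entropy

/-! ### Concentration of the score in the universal basis -/

section StateConcentration

open Matrix

variable {d n : ℕ}

variable {U : Matrix (Fin n → Fin d) (Fin n → Fin d) ℂ} {l : (Fin n → Fin d) → ℝ}

/-- The squared overlaps of the rows of `U` with the product eigenvectors of `ρ^{⊗ n}`. -/
noncomputable def overlap (U : Matrix (Fin n → Fin d) (Fin n → Fin d) ℂ)
    {ρ : Matrix (Fin d) (Fin d) ℂ} (h : ρ.IsHermitian) (x j : Fin n → Fin d) : ℝ :=
  ‖(U * tensorPower (h.eigenvectorUnitary : Matrix (Fin d) (Fin d) ℂ) n) x j‖ ^ 2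

theorem rotatedWeight_tensorPower (U : Matrix (Fin n → Fin d) (Fin n → Fin d) ℂ)
    {ρ : Matrix (Fin d) (Fin d) ℂ} (h : ρ.IsHermitian) (x : Fin n → Fin d) :
    rotatedWeight U (tensorPower ρ n) x =
      ∑ j, (∏ i, h.eigenvalues (j i)) * overlap U h x j := by
  set Q := U * tensorPower (h.eigenvectorUnitary : Matrix (Fin d) (Fin d) ℂ) n with hQ
  have h1 : U * tensorPower ρ n * Uᴴ =
      Q * diagonal (fun j => ((∏ i, h.eigenvalues (j i) : ℝ) : ℂ)) * Qᴴ := by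
    have h2 : tensorPower ρ n = _ :=
      congrArg (fun A => tensorPower A n) (eq_mul_diagonal_mul h)
    rw [h2, tensorPower_mul, tensorPower_mul, tensorPower_conjTranspose, tensorPower_diagonal, hQ,
      conjTranspose_mul]
    push_cast
    simp only [Matrix.mul_assoc]
  have h3 : (U * tensorPower ρ n * Uᴴ) x x =
      ((∑ j, (∏ i, h.eigenvalues (j i)) * overlap U h x j : ℝ) : ℂ) := by
    rw [h1, mul_apply]
    push_cast
    refine Finset.sum_congr rfl fun j _ => ?_
    rw [mul_diagonal, conjTranspose_apply, overlap, ← hQ]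
    push_cast
    rw [← Complex.mul_conj', starRingEnd_apply]
    ring
  rw [rotatedWeight, h3, Complex.ofReal_re]

/-- This is `dominates` for the square root B = V √p of ρ: column j of U B^{⊗n} has squared entries
equal to the eigenvalue times the overlap. -/
theorem IsUniversalBasis.overlap_dominated (hU : IsUniversalBasis U l)
    {ρ : Matrix (Fin d) (Fin d) ℂ} (hρ : IsDensity ρ) (j : Fin n → Fin d)
    (S : Finset (Fin n → Fin d)) :
    (∑ x ∈ S, (∏ i, hρ.1.1.eigenvalues (j i)) * overlap U hρ.1.1 x j) ^ 2 ≤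
      ((n : ℝ) + 1) ^ (d * d) *
        ∑ x ∈ S, l x * ((∏ i, hρ.1.1.eigenvalues (j i)) * overlap U hρ.1.1 x j) := by
  set p := hρ.1.1.eigenvalues with hp
  have hp0 : ∀ i, 0 ≤ p i := hρ.1.eigenvalues_nonneg
  set V := (hρ.1.1.eigenvectorUnitary : Matrix (Fin d) (Fin d) ℂ) with hV
  set B := V * diagonal (fun i => (Real.sqrt (p i) : ℂ)) with hB
  have hBn : ∀ a b, ‖B a b‖ ^ 2 = ‖V a b‖ ^ 2 * p b := by
    intro a b
    rw [hB, mul_diagonal, norm_mul, mul_pow, Complex.norm_real, Real.norm_eq_abs, sq_abs,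
      Real.sq_sqrt (hp0 b)]
  have hB1 : ∑ a, ∑ b, ‖B a b‖ ^ 2 = 1 := by
    simp only [hBn]
    rw [Finset.sum_comm]
    simp only [← Finset.sum_mul, hV, sum_norm_sq_col hρ.1.1.eigenvectorUnitary.2, one_mul]
    exact hρ.sum_eigenvalues
  have hq : ∀ x, ‖(U * tensorPower B n) x j‖ ^ 2 = (∏ i, p (j i)) * overlap U hρ.1.1 x j := by
    intro x
    rw [hB, tensorPower_mul, tensorPower_diagonal, ← Matrix.mul_assoc, mul_diagonal, norm_mul,
      mul_pow, mul_comm, overlap, norm_prod, ← Finset.prod_pow]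
    congr 1
    refine Finset.prod_congr rfl fun i _ => ?_
    rw [Complex.norm_real, Real.norm_eq_abs, sq_abs, Real.sq_sqrt (hp0 _)]
  have := hU.dominates B hB1 j S
  simpa only [hq] using this

/-- The weight of a set of sequences that is a union of type classes is not changed by `U`. -/
theorem IsUniversalBasis.sum_rotatedWeight_eq (hU : IsUniversalBasis U l)
    {ρ : Matrix (Fin d) (Fin d) ℂ} (hρ : IsDensity ρ) (P : (Fin n → Fin d) → Prop)
    [DecidablePred P] (hP : ∀ x y, typeCount x = typeCount y → (P x ↔ P y)) :
    (∑ x, if P x then rotatedWeight U (tensorPower ρ n) x else 0) =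
      ∑ x, if P x then ∏ i, (ρ (x i) (x i)).re else 0 := by
  set D : Matrix (Fin n → Fin d) (Fin n → Fin d) ℂ := diagonal fun x => if P x then 1 else 0 with hD
  -- U mixes only sequences of equal type, so it commutes with the projector onto P and drops out of
  -- the trace.
  have hcomm : D * U = U * D := by
    ext x y
    rw [hD, diagonal_mul, mul_diagonal]
    by_cases h0 : U x y = 0
    · simp [h0]
    · rw [mul_comm]
      simp only [hP x y (hU.block x y h0)]
  have htr : trace (D * (U * tensorPower ρ n * Uᴴ)) = trace (D * tensorPower ρ n) := by
    have h1 : Uᴴ * U = 1 := mem_unitaryGroup_iff'.1 hU.unitary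
    rw [← Matrix.mul_assoc, trace_mul_comm, ← Matrix.mul_assoc D, hcomm, Matrix.mul_assoc,
      ← Matrix.mul_assoc Uᴴ, h1, Matrix.one_mul]
  have h2 := congrArg Complex.re htr
  simp only [trace, diag_apply, hD, diagonal_mul, Complex.re_sum] at h2
  have h3 : ∀ x : Fin n → Fin d, (tensorPower ρ n x x).re = ∏ i, (ρ (x i) (x i)).re := by
    intro x
    have : tensorPower ρ n x x = ((∏ i, (ρ (x i) (x i)).re : ℝ) : ℂ) := by
      push_cast
      exact Finset.prod_congr rfl fun i _ => hρ.diag_eq _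
    rw [this, Complex.ofReal_re]
  convert h2 using 2 with x _ x _
  · split_ifs <;> simp [rotatedWeight]
  · split_ifs <;> simp [h3]

/-- The score whose mean is the relative entropy to the Gibbs state. -/
noncomputable def workScore (β : ℝ) (E : Fin d → ℝ) (l : (Fin n → Fin d) → ℝ)
    (x : Fin n → Fin d) : ℝ :=
  β * copiesEnergy E n x + Real.log (l x) + n * Real.log (partitionFn β E)

theorem log_prod_eigenvalues {p : Fin d → ℝ} (j : Fin n → Fin d)
    (h : ∏ i, p (j i) ≠ 0) : Real.log (∏ i, p (j i)) = ∑ i, Real.log (p (j i)) :=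
  Real.log_prod fun i _ => Finset.prod_ne_zero_iff.1 h i (Finset.mem_univ i)

open Classical in
/-- In the universal basis the score concentrates around its mean. -/
theorem exists_concentration_const [NeZero d] {β : ℝ} (hβ : 0 < β) (E : Fin d → ℝ)
    {ρ : Matrix (Fin d) (Fin d) ℂ} (hρ : IsDensity ρ) :
    ∃ C : ℝ, ∀ (n : ℕ) (U : Matrix (Fin n → Fin d) (Fin n → Fin d) ℂ) (l : (Fin n → Fin d) → ℝ),
      0 < n → IsUniversalBasis U l → ∀ δ : ℝ, 0 < δ →
      (∑ x, if 0 < l x ∧ |workScore β E l x - n * relEntropy ρ (gibbs β E)| < n * ((2 + β) * δ)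
        then 0 else rotatedWeight U (tensorPower ρ n) x) ≤
        C / (n * δ ^ 2) + 2 * (((n : ℝ) + 1) ^ (d * d) * Real.exp (-(n * δ))) := by
  set p := hρ.1.1.eigenvalues with hp
  have hp0 : ∀ i, 0 ≤ p i := hρ.1.eigenvalues_nonneg
  set s := eigenEntropy hρ.1.1 with hs
  set V₁ := ∑ a, p a * (-Real.log (p a) - ∑ b, p b * -Real.log (p b)) ^ 2 with hV₁
  set V₂ := ∑ a, (ρ a a).re * (E a - ∑ b, (ρ b b).re * E b) ^ 2 with hV₂
  refine ⟨2 * V₁ + V₂, fun n U l hn hU δ hδ => ?_⟩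
  have hn' : (0 : ℝ) < n := by exact_mod_cast hn
  set v : ℝ := ((n : ℝ) + 1) ^ (d * d) with hv
  have hv0 : 0 ≤ v := by positivity
  set P := rotatedWeight U (tensorPower ρ n) with hP
  have hP0 : ∀ x, 0 ≤ P x := by
    intro x
    rw [hP, rotatedWeight_tensorPower U hρ.1.1]
    exact Finset.sum_nonneg fun j _ => mul_nonneg (Finset.prod_nonneg fun i _ => hp0 _)
      (sq_nonneg _)
  set pj : (Fin n → Fin d) → ℝ := fun j => ∏ i, p (j i) with hpj
  have hpj0 : ∀ j, 0 ≤ pj j := fun j => Finset.prod_nonneg fun i _ => hp0 _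
  have hpj1 : ∑ j, pj j = 1 := by
    rw [hpj, sum_pi_prod fun _ a => p a]
    simp [hp, hρ.sum_eigenvalues]
  have hc0 : ∀ x j, 0 ≤ overlap U hρ.1.1 x j := fun x j => sq_nonneg _
  have hQ : U * tensorPower (hρ.1.1.eigenvectorUnitary : Matrix (Fin d) (Fin d) ℂ) n ∈
      unitaryGroup (Fin n → Fin d) ℂ :=
    mul_mem hU.unitary (tensorPower_mem_unitaryGroup hρ.1.1.eigenvectorUnitary.2)
  have hcol : ∀ j, ∑ x, overlap U hρ.1.1 x j = 1 := sum_norm_sq_col hQ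
  have hrow : ∀ x, ∑ j, overlap U hρ.1.1 x j = 1 := sum_norm_sq_row hQ
  have hlln : (∑ j : Fin n → Fin d,
      if n * δ ≤ |∑ k, -Real.log (p (j k)) - n * s| then pj j else 0) ≤
      V₁ / (n * δ ^ 2) := by
    refine (sum_prod_deviation_le p (fun a => -Real.log (p a)) hp0 hρ.sum_eigenvalues
      (mul_pos hn' hδ)).trans (le_of_eq ?_)
    rw [← hV₁]
    field_simp
  have hlnE : (∑ x : Fin n → Fin d, if n * δ ≤ |copiesEnergy E n x - n * meanEnergy E ρ|
      then ∏ k, (ρ (x k) (x k)).re else 0) ≤ V₂ / (n * δ ^ 2) := by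
    refine (sum_prod_deviation_le (fun a => (ρ a a).re) E hρ.diag_re_nonneg hρ.sum_diag_re
      (mul_pos hn' hδ)).trans (le_of_eq ?_)
    rw [← hV₂]
    field_simp
  -- Sequences through the kernel of ρ are excluded, since `Real.log 0 = 0` would break additivity;
  -- they have weight zero anyway.
  have hlog : ∀ j, pj j ≠ 0 → Real.log (pj j) = - ∑ k, -Real.log (p (j k)) := by
    intro j h
    rw [hpj, log_prod_eigenvalues j h, Finset.sum_neg_distrib, neg_neg]
  -- The eigenvalue cutoff e^{-n(s+δ)} lies between the threshold e^{-n(s+2δ)} for l and the typical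
  -- eigenvalue e^{-ns}: the gap to the first costs v e^{-nδ}, the gap to the second a Chebyshev
  -- term.
  have hsmall : ∑ x ∈ Finset.univ.filter (fun x => l x ≤ Real.exp (-(n * (s + 2 * δ)))), P x ≤
      V₁ / (n * δ ^ 2) + v * Real.exp (-(n * δ)) := by
    have h1 := sum_weight_le_of_small pj (overlap U hρ.1.1) l v hpj0 hpj1 hc0 hcol hv0
      (hU.overlap_dominated hρ) (s := Real.exp (-(n * (s + 2 * δ))))
      (t := Real.exp (-(n * (s + δ)))) (Real.exp_pos _).le (Real.exp_pos _)
      (Finset.univ.filter (fun x => l x ≤ Real.exp (-(n * (s + 2 * δ)))))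
      (fun x hx => (Finset.mem_filter.1 hx).2)
    simp only [hP, rotatedWeight_tensorPower U hρ.1.1]
    refine h1.trans (add_le_add (le_trans (Finset.sum_le_sum fun j _ => ?_) hlln) (le_of_eq ?_))
    · by_cases h0 : pj j = 0
      · simp [h0]
      · have hpos := lt_of_le_of_ne (hpj0 j) (Ne.symm h0)
        split_ifs with h2 h3 h3
        · exact le_rfl
        · exfalso
          apply h3
          have h4 := (Real.log_lt_iff_lt_exp hpos).2 h2
          rw [hlog j h0] at h4
          rw [le_abs]
          left
          linarith
        · exact hpj0 j
        · exact le_rfl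
    · rw [mul_div_assoc, ← Real.exp_sub]
      congr 2
      ring
  have hlarge : ∑ x ∈ Finset.univ.filter (fun x => Real.exp (-(n * (s - 2 * δ))) ≤ l x), P x ≤
      V₁ / (n * δ ^ 2) + v * Real.exp (-(n * δ)) := by
    have h1 := sum_weight_le_of_large pj (overlap U hρ.1.1) l v hpj0 hc0 hcol hrow hU.nonneg
      hU.sum_le (s := Real.exp (-(n * (s - 2 * δ))))
      (t := Real.exp (-(n * (s - δ)))) (Real.exp_pos _) (Real.exp_pos _).le
      (Finset.univ.filter (fun x => Real.exp (-(n * (s - 2 * δ))) ≤ l x))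
      (fun x hx => (Finset.mem_filter.1 hx).2)
    simp only [hP, rotatedWeight_tensorPower U hρ.1.1]
    refine h1.trans (add_le_add (le_trans (Finset.sum_le_sum fun j _ => ?_) hlln) (le_of_eq ?_))
    · by_cases h0 : pj j = 0
      · simp [h0]
      · have hpos := lt_of_le_of_ne (hpj0 j) (Ne.symm h0)
        split_ifs with h2 h3 h3
        · exact le_rfl
        · exfalso
          apply h3
          have h4 := (Real.lt_log_iff_exp_lt hpos).2 h2
          rw [hlog j h0] at h4
          rw [le_abs]
          right
          linarith
        · exact hpj0 j
        · exact le_rfl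
    · rw [mul_comm (Real.exp _), mul_div_assoc, ← Real.exp_sub]
      congr 2
      ring
  -- Energy is a function of the type, so its law under U is that of independent draws from the
  -- diagonal of ρ.
  have henergy : ∑ x ∈ Finset.univ.filter
      (fun x => n * δ ≤ |copiesEnergy E n x - n * meanEnergy E ρ|), P x ≤ V₂ / (n * δ ^ 2) := by
    rw [Finset.sum_filter, hP, hU.sum_rotatedWeight_eq hρ
      (fun x => n * δ ≤ |copiesEnergy E n x - n * meanEnergy E ρ|) (by
        intro x y h
        rw [copiesEnergy_eq_sum_typeCount, copiesEnergy_eq_sum_typeCount, h])]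
    exact hlnE
  rw [Finset.sum_filter] at hsmall hlarge henergy
  -- Outside the three bad events log l is within 2nδ of -ns and the energy within nδ of its mean,
  -- so the score is off by less than (2 + β)nδ.
  have hpoint : ∀ x, (if 0 < l x ∧
      |workScore β E l x - n * relEntropy ρ (gibbs β E)| < n * ((2 + β) * δ) then 0 else P x) ≤
      (if l x ≤ Real.exp (-(n * (s + 2 * δ))) then P x else 0) +
      (if Real.exp (-(n * (s - 2 * δ))) ≤ l x then P x else 0) +
      (if n * δ ≤ |copiesEnergy E n x - n * meanEnergy E ρ| then P x else 0) := by
    intro x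
    have hPx := hP0 x
    by_cases h1 : l x ≤ Real.exp (-(n * (s + 2 * δ)))
    · rw [if_pos h1]
      split_ifs <;> linarith
    by_cases h2 : Real.exp (-(n * (s - 2 * δ))) ≤ l x
    · rw [if_pos h2]
      split_ifs <;> linarith
    by_cases h3 : n * δ ≤ |copiesEnergy E n x - n * meanEnergy E ρ|
    · rw [if_pos h3]
      split_ifs <;> linarith
    rw [if_neg h1, if_neg h2, if_neg h3, if_pos]
    · simp
    push Not at h1 h2 h3
    have hlx : 0 < l x := (Real.exp_pos _).trans h1
    refine ⟨hlx, ?_⟩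
    have h4 := (Real.lt_log_iff_exp_lt hlx).2 h1
    have h5 := (Real.log_lt_iff_lt_exp hlx).2 h2
    rw [abs_lt] at h3
    have h6 := mul_lt_mul_of_pos_left h3.1 hβ
    have h7 := mul_lt_mul_of_pos_left h3.2 hβ
    rw [relEntropy_gibbs β E hρ, workScore, abs_lt, ← hs]
    constructor <;> nlinarith
  calc _ ≤ _ := Finset.sum_le_sum fun x _ => hpoint x
    _ ≤ (V₁ / (n * δ ^ 2) + v * Real.exp (-(n * δ))) +
        (V₁ / (n * δ ^ 2) + v * Real.exp (-(n * δ))) + V₂ / (n * δ ^ 2) := by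
        rw [Finset.sum_add_distrib, Finset.sum_add_distrib]
        exact add_le_add (add_le_add hsmall hlarge) henergy
    _ = _ := by ring

end StateConcentration

/-! ### Rounding to alternating grids -/

section Grid

/-- The width of the cells in which the work per copy is resolved. -/
noncomputable def gridWidth (n : ℕ) : ℝ := (((n / 2 : ℕ) : ℝ) + 1) ^ (-(1 / 4) : ℝ)

/-- The cells for odd `n` are shifted by half a width: every point is away from the boundary of its
cell for one of `2 * k` and `2 * k + 1`. -/
noncomputable def gridOffset (n : ℕ) : ℝ := if Even n then 0 else 1 / 2

/-- The lower end of the cell of `u`. -/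
noncomputable def gridFloor (n : ℕ) (u : ℝ) : ℝ :=
  gridWidth n * (⌊u / gridWidth n - gridOffset n⌋ + gridOffset n)

theorem gridWidth_pos (n : ℕ) : 0 < gridWidth n := Real.rpow_pos_of_pos (by positivity) _

theorem gridFloor_le (n : ℕ) (u : ℝ) : gridFloor n u ≤ u := by
  have hw := gridWidth_pos n
  have h := Int.floor_le (u / gridWidth n - gridOffset n)
  calc gridFloor n u ≤ gridWidth n * (u / gridWidth n) :=
        mul_le_mul_of_nonneg_left (by linarith) hw.le
    _ = u := by field_simp

theorem lt_gridFloor_add (n : ℕ) (u : ℝ) : u < gridFloor n u + gridWidth n := by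
  have hw := gridWidth_pos n
  have h := Int.lt_floor_add_one (u / gridWidth n - gridOffset n)
  calc u = gridWidth n * (u / gridWidth n) := by field_simp
    _ < gridWidth n * (⌊u / gridWidth n - gridOffset n⌋ + 1 + gridOffset n) :=
        mul_lt_mul_of_pos_left (by linarith) hw
    _ = _ := by rw [gridFloor]; ring

theorem gridFloor_eq_of_near {n : ℕ} {u D : ℝ} {m : ℤ}
    (h₁ : (m : ℝ) + 1 / 4 ≤ D / gridWidth n - gridOffset n)
    (h₂ : D / gridWidth n - gridOffset n ≤ m + 3 / 4) (hu : |u - D| < gridWidth n / 4) :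
    gridFloor n u = gridFloor n D := by
  have hw := gridWidth_pos n
  rw [abs_lt] at hu
  have h3 : D / gridWidth n - 1 / 4 < u / gridWidth n := by
    rw [lt_div_iff₀ hw, sub_mul, div_mul_cancel₀ _ hw.ne']
    linarith
  have h4 : u / gridWidth n < D / gridWidth n + 1 / 4 := by
    rw [div_lt_iff₀ hw, add_mul, div_mul_cancel₀ _ hw.ne']
    linarith
  have h5 : ⌊u / gridWidth n - gridOffset n⌋ = m :=
    Int.floor_eq_iff.2 ⟨by linarith, by linarith⟩
  have h6 : ⌊D / gridWidth n - gridOffset n⌋ = m :=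
    Int.floor_eq_iff.2 ⟨by linarith, by linarith⟩
  rw [gridFloor, gridFloor, h5, h6]

/-- Both values of n share one width, as it depends on n / 2 only. If D / width lies within a
quarter of an integer, the half shift of the odd grid moves it into the middle half of a cell. -/
theorem exists_away_from_boundary (D : ℝ) (k : ℕ) :
    ∃ n, (n = 2 * k ∨ n = 2 * k + 1) ∧ ∃ m : ℤ,
      (m : ℝ) + 1 / 4 ≤ D / gridWidth n - gridOffset n ∧
      D / gridWidth n - gridOffset n ≤ m + 3 / 4 := by
  have hw0 : gridWidth (2 * k) = ((k : ℝ) + 1) ^ (-(1 / 4) : ℝ) := by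
    rw [gridWidth, Nat.mul_div_cancel_left k two_pos]
  have hw1 : gridWidth (2 * k + 1) = ((k : ℝ) + 1) ^ (-(1 / 4) : ℝ) := by
    rw [gridWidth, show (2 * k + 1) / 2 = k by omega]
  have ho0 : gridOffset (2 * k) = 0 := by simp [gridOffset]
  have ho1 : gridOffset (2 * k + 1) = 1 / 2 := by simp [gridOffset]
  set y := D / ((k : ℝ) + 1) ^ (-(1 / 4) : ℝ) with hy
  have h1 := Int.floor_le y
  have h2 := Int.lt_floor_add_one y
  by_cases h3 : y < ⌊y⌋ + 1 / 4
  · refine ⟨2 * k + 1, Or.inr rfl, ⌊y⌋ - 1, ?_, ?_⟩ <;> rw [hw1, ho1, ← hy] <;> push_cast <;>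
      linarith
  by_cases h4 : y < ⌊y⌋ + 3 / 4
  · refine ⟨2 * k, Or.inl rfl, ⌊y⌋, ?_, ?_⟩ <;> rw [hw0, ho0, ← hy] <;> linarith
  · refine ⟨2 * k + 1, Or.inr rfl, ⌊y⌋, ?_, ?_⟩ <;> rw [hw1, ho1, ← hy] <;> linarith

theorem tendsto_natCast_add_one_atTop : Tendsto (fun n : ℕ => (n : ℝ) + 1) atTop atTop :=
  tendsto_atTop_add_const_right _ _ tendsto_natCast_atTop_atTop

theorem tendsto_gridWidth : Tendsto gridWidth atTop (𝓝 0) := by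
  have h1 : Tendsto (fun n : ℕ => ((n / 2 : ℕ) : ℝ) + 1) atTop atTop :=
    tendsto_natCast_add_one_atTop.comp (Nat.tendsto_div_const_atTop two_ne_zero)
  exact (tendsto_rpow_neg_atTop (by norm_num : (0 : ℝ) < 1 / 4)).comp h1

theorem le_gridWidth (n : ℕ) : ((n : ℝ) + 1) ^ (-(1 / 4) : ℝ) ≤ gridWidth n := by
  refine Real.rpow_le_rpow_of_nonpos (by positivity) ?_ (by norm_num)
  have : ((n / 2 : ℕ) : ℝ) ≤ n := by exact_mod_cast Nat.div_le_self n 2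
  linarith

/-- The bound on the failure probability tends to zero at the scale of the grid. -/
theorem tendsto_deviation_bound (C : ℝ) {c : ℝ} (hc : 0 < c) (k : ℕ) :
    Tendsto (fun n : ℕ => C / (n * (c * gridWidth n) ^ 2) +
      2 * (((n : ℝ) + 1) ^ k * Real.exp (-(n * (c * gridWidth n))))) atTop (𝓝 0) := by
  have hm := tendsto_natCast_add_one_atTop
  -- Width n^{-1/4} shrinks more slowly than the fluctuation scale n^{-1/2}: n times its square
  -- grows like n^{1/2}, so Chebyshev applies, and n times it grows like n^{3/4}, so the exponential
  -- beats any polynomial.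
  have hpow : ∀ n : ℕ, 0 < n → c / 2 * ((n : ℝ) + 1) ^ (3 / 4 : ℝ) ≤ n * (c * gridWidth n) := by
    intro n hn
    have hn' : (1 : ℝ) ≤ n := by exact_mod_cast hn
    have h1 : ((n : ℝ) + 1) ^ (3 / 4 : ℝ) = ((n : ℝ) + 1) * ((n : ℝ) + 1) ^ (-(1 / 4) : ℝ) := by
      rw [← Real.rpow_one_add' (by positivity) (by norm_num)]
      norm_num
    rw [h1]
    have h2 := le_gridWidth n
    have h3 : (0 : ℝ) ≤ ((n : ℝ) + 1) ^ (-(1 / 4) : ℝ) := by positivity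
    have h4 : ((n : ℝ) + 1) / 2 * ((n : ℝ) + 1) ^ (-(1 / 4) : ℝ) ≤ n * gridWidth n :=
      mul_le_mul (by linarith) h2 h3 (by positivity)
    nlinarith
  have hsq : ∀ n : ℕ, 0 < n →
      c ^ 2 / 2 * ((n : ℝ) + 1) ^ (1 / 2 : ℝ) ≤ n * (c * gridWidth n) ^ 2 := by
    intro n hn
    have h1 : ((n : ℝ) + 1) ^ (1 / 2 : ℝ) =
        ((n : ℝ) + 1) ^ (3 / 4 : ℝ) * ((n : ℝ) + 1) ^ (-(1 / 4) : ℝ) := by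
      rw [← Real.rpow_add (by positivity)]
      norm_num
    have h2 := le_gridWidth n
    have h3 : (0 : ℝ) ≤ ((n : ℝ) + 1) ^ (-(1 / 4) : ℝ) := by positivity
    calc c ^ 2 / 2 * ((n : ℝ) + 1) ^ (1 / 2 : ℝ)
        = (c / 2 * ((n : ℝ) + 1) ^ (3 / 4 : ℝ)) * (c * ((n : ℝ) + 1) ^ (-(1 / 4) : ℝ)) := by
          rw [h1]; ring
      _ ≤ (n * (c * gridWidth n)) * (c * gridWidth n) := by
          refine mul_le_mul (hpow n hn) (mul_le_mul_of_nonneg_left h2 hc.le) (by positivity) ?_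
          have := gridWidth_pos n
          positivity
      _ = _ := by ring
  have hfirst : Tendsto (fun n : ℕ => C / (n * (c * gridWidth n) ^ 2)) atTop (𝓝 0) := by
    refine Tendsto.div_atTop tendsto_const_nhds ?_
    refine tendsto_atTop_mono' _ ?_ (((tendsto_rpow_atTop
      (by norm_num : (0 : ℝ) < 1 / 2)).comp hm).const_mul_atTop (by positivity : 0 < c ^ 2 / 2))
    filter_upwards [eventually_gt_atTop 0] with n hn using hsq n hn
  have hsecond : Tendsto (fun n : ℕ => ((n : ℝ) + 1) ^ k *
      Real.exp (-(n * (c * gridWidth n)))) atTop (𝓝 0) := by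
    -- In the variable y = (n+1)^{3/4} the polynomial (n+1)^k is y^{4k/3}.
    have h1 := (tendsto_rpow_mul_exp_neg_mul_atTop_nhds_zero (4 / 3 * k) (c / 2)
      (by positivity)).comp ((tendsto_rpow_atTop (by norm_num : (0 : ℝ) < 3 / 4)).comp hm)
    refine squeeze_zero' (Eventually.of_forall fun n => by positivity) ?_ h1
    filter_upwards [eventually_gt_atTop 0] with n hn
    have h2 : (((n : ℝ) + 1) ^ (3 / 4 : ℝ)) ^ (4 / 3 * k : ℝ) = ((n : ℝ) + 1) ^ k := by
      rw [← Real.rpow_mul (by positivity), ← Real.rpow_natCast]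
      congr 1
      ring
    simp only [Function.comp, h2]
    refine mul_le_mul_of_nonneg_left (Real.exp_le_exp.2 ?_) (by positivity)
    have := hpow n hn
    linarith
  simpa using hfirst.add (hsecond.const_mul 2)

theorem tendsto_log_div_natCast (k : ℕ) :
    Tendsto (fun n : ℕ => Real.log (2 * ((n : ℝ) + 1) ^ k) / n) atTop (𝓝 0) := by
  have h1 := (Real.tendsto_pow_log_div_mul_add_atTop 1 (-1) 1 one_ne_zero).comp
    tendsto_natCast_add_one_atTop
  have h2 : Tendsto (fun n : ℕ => Real.log 2 / (n : ℝ)) atTop (𝓝 0) :=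
    tendsto_const_nhds.div_atTop tendsto_natCast_atTop_atTop
  have h3 := h2.add (h1.const_mul (k : ℝ))
  simp only [mul_zero, add_zero] at h3
  refine h3.congr fun n => ?_
  simp only [Function.comp, pow_one, one_mul, add_neg_cancel_right]
  rw [Real.log_mul two_ne_zero (by positivity), Real.log_pow]
  ring

end Grid

/-! ### The work assignment and its level sets -/

section Assignment

variable {d n : ℕ} {E : Fin d → ℝ}

/-- Multiples of a level of the work storage. -/
def workMultiple (g : workSet E) (m : ℕ) : workSet E :=
  ⟨m * g, mul_nonneg (Nat.cast_nonneg _) g.2.1, by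
    obtain ⟨N, h1, h2⟩ := g.2.2
    refine ⟨fun i => m * N i, by rw [← Finset.mul_sum, h1, mul_zero], ?_⟩
    rw [h2, Finset.mul_sum]
    refine Finset.sum_congr rfl fun i _ => ?_
    push_cast
    ring⟩

/-- The number of quanta `g` extracted at score `u` per copy. -/
noncomputable def workQuanta (β : ℝ) (g : workSet E) (n : ℕ) (u : ℝ) : ℕ :=
  ⌊(n * gridFloor n u - Real.log (2 * ((n : ℝ) + 1) ^ (d * d))) / (β * g)⌋₊

/-- The work extracted from the universal basis vector labelled by `x`. -/
noncomputable def workAssignment (β : ℝ) (g : workSet E) (l : (Fin n → Fin d) → ℝ)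
    (x : Fin n → Fin d) : workSet E :=
  open Classical in
  -- At l x = 0 the score is meaningless because `Real.log 0 = 0`; such vectors extract nothing.
  if 0 < l x then workMultiple g (workQuanta β g n (workScore β E l x / n)) else workGround E

/-- Rounding down never overshoots, except that the natural-number floor truncates negative values
to 0. That case lands in the ground state and is excluded. -/
theorem le_workScore_of_workAssignment {β : ℝ} (hβ : 0 < β) (hn : 0 < n) {g : workSet E}
    {l : (Fin n → Fin d) → ℝ} {x : Fin n → Fin d} (h : workAssignment β g l x ≠ workGround E) :
    0 < l x ∧ β * (workAssignment β g l x : ℝ) ≤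
      workScore β E l x - Real.log (2 * ((n : ℝ) + 1) ^ (d * d)) := by
  have hn' : (0 : ℝ) < n := by exact_mod_cast hn
  unfold workAssignment at h ⊢
  split_ifs at h ⊢ with hl
  · refine ⟨hl, ?_⟩
    set m := workQuanta β g n (workScore β E l x / n) with hm
    have hmg : (m : ℝ) * g ≠ 0 := fun h0 => h (Subtype.ext h0)
    have hg : 0 < (g : ℝ) := lt_of_le_of_ne g.2.1 (Ne.symm (right_ne_zero_of_mul hmg))
    have hm0 : m ≠ 0 := fun h0 => left_ne_zero_of_mul hmg (by simp [h0])
    have h1 : (m : ℝ) ≤ (n * gridFloor n (workScore β E l x / n) -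
        Real.log (2 * ((n : ℝ) + 1) ^ (d * d))) / (β * g) :=
      (Nat.le_floor_iff' hm0).1 (le_of_eq hm)
    rw [le_div_iff₀ (by positivity)] at h1
    have h2 := mul_le_mul_of_nonneg_left (gridFloor_le n (workScore β E l x / n)) hn'.le
    rw [mul_div_cancel₀ _ hn'.ne'] at h2
    have h3 : ((workMultiple g m : workSet E) : ℝ) = m * g := rfl
    rw [h3]
    linarith
  · exact absurd rfl h

theorem sum_exp_copiesEnergy [NeZero d] (β : ℝ) (E : Fin d → ℝ) (n : ℕ) :
    ∑ x : Fin n → Fin d, Real.exp (-β * copiesEnergy E n x) = partitionFn β E ^ n := by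
  have : ∀ x : Fin n → Fin d, Real.exp (-β * copiesEnergy E n x) =
      ∏ k, Real.exp (-β * E (x k)) := by
    intro x
    rw [copiesEnergy, Finset.mul_sum, Real.exp_sum]
  simp only [this]
  rw [sum_pi_prod fun _ a => Real.exp (-β * E a), partitionFn_eq_sum]
  simp

/-- The level sets of the work assignment are small enough for a thermal operation. -/
theorem sum_exp_workAssignment_le [NeZero d] {β : ℝ} (hβ : 0 < β) (hn : 0 < n) (g : workSet E)
    {U : Matrix (Fin n → Fin d) (Fin n → Fin d) ℂ} {l : (Fin n → Fin d) → ℝ}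
    (hU : IsUniversalBasis U l) (W : workSet E) (hW : W ≠ workGround E) :
    2 * (∑ x, open Classical in if workAssignment β g l x = W then
        Real.exp (-β * copiesEnergy E n x) else 0) ≤
      Real.exp (-β * W) * ∑ x : Fin n → Fin d, Real.exp (-β * copiesEnergy E n x) := by
  classical
  rw [sum_exp_copiesEnergy]
  set v : ℝ := ((n : ℝ) + 1) ^ (d * d) with hv
  have hv0 : 0 < v := by positivity
  have hZ := partitionFn_pos β E
  set a := Real.exp (-β * W) * partitionFn β E ^ n with ha
  have ha0 : 0 < a := by positivity
  -- Exponentiating the score bound turns it into e^{-βE(x)} ≤ e^{-βW} Z^n l(x) / (2v); the bounded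
  -- total of l then controls the whole level set.
  have hpoint : ∀ x, 2 * (if workAssignment β g l x = W then
      Real.exp (-β * copiesEnergy E n x) else 0) ≤ a / v * l x := by
    intro x
    split_ifs with hx
    · obtain ⟨h1, h2⟩ := le_workScore_of_workAssignment hβ hn (hx.symm ▸ hW)
      rw [hx] at h2
      have h3 : 2 * v * Real.exp (β * W) ≤
          Real.exp (β * copiesEnergy E n x) * l x * partitionFn β E ^ n := by
        have h4 : Real.exp (β * W + Real.log (2 * v)) ≤ Real.exp (workScore β E l x) :=
          Real.exp_le_exp.2 (by linarith)
        rw [Real.exp_add, Real.exp_log (by positivity), workScore, Real.exp_add, Real.exp_add,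
          Real.exp_log h1, Real.exp_nat_mul, Real.exp_log hZ] at h4
        linarith
      rw [ha, neg_mul, neg_mul, Real.exp_neg, Real.exp_neg]
      have e1 := Real.exp_pos (β * copiesEnergy E n x)
      have e2 := Real.exp_pos (β * (W : ℝ))
      rw [← div_eq_mul_inv, div_le_iff₀ e1]
      rw [show (Real.exp (β * (W : ℝ)))⁻¹ * partitionFn β E ^ n / v * l x *
        Real.exp (β * copiesEnergy E n x) = (Real.exp (β * copiesEnergy E n x) * l x *
          partitionFn β E ^ n) / (v * Real.exp (β * W)) by field_simp, le_div_iff₀ (by positivity)]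
      linarith
    · have := hU.nonneg x
      simp only [mul_zero]
      positivity
  calc _ = ∑ x, 2 * (if workAssignment β g l x = W then
          Real.exp (-β * copiesEnergy E n x) else 0) := by rw [Finset.mul_sum]
    _ ≤ ∑ x, a / v * l x := Finset.sum_le_sum fun x _ => hpoint x
    _ = a / v * ∑ x, l x := by rw [Finset.mul_sum]
    _ ≤ a / v * v := mul_le_mul_of_nonneg_left hU.sum_le (by positivity)
    _ = a := by field_simp

/-- A positive gap E j - E i serves as the unit of work. For d = 1 the storage has only the level 0
and the relative entropy vanishes, so no unit is needed. -/
theorem exists_workSet_quantum (E : Fin d → ℝ) (hE : d = 1 ∨ ∃ i j, E i ≠ E j) :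
    ∃ g : workSet E, d = 1 ∨ 0 < (g : ℝ) := by
  rcases hE with h | ⟨i, j, hij⟩
  · exact ⟨workGround E, Or.inl h⟩
  · have key : ∀ i j : Fin d, E i < E j → ∃ g : workSet E, d = 1 ∨ 0 < (g : ℝ) := by
      intro i j h
      refine ⟨⟨E j - E i, by linarith, Pi.single j 1 - Pi.single i 1, ?_, ?_⟩, Or.inr ?_⟩
      · simp [Finset.sum_sub_distrib]
      · simp [sub_mul, Finset.sum_sub_distrib, Pi.single_apply]
      · simpa using h
    rcases lt_or_gt_of_ne hij with h | h
    · exact key i j h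
    · exact key j i h

theorem relEntropy_gibbs_of_dim_one (β : ℝ) (E : Fin 1 → ℝ) {ρ : Matrix (Fin 1) (Fin 1) ℂ}
    (hρ : IsDensity ρ) : relEntropy ρ (gibbs β E) = 0 := by
  have h1 := hρ.sum_eigenvalues
  have h2 := hρ.sum_diag_re
  simp only [Finset.univ_unique, Fin.default_eq_zero, Finset.sum_singleton] at h1 h2
  rw [relEntropy_gibbs β E hρ]
  simp [meanEnergy, eigenEntropy, partitionFn_eq_sum, h1, h2]

theorem posSemidef_tensorPower {ρ : Matrix (Fin d) (Fin d) ℂ} (hρ : ρ.PosSemidef) (n : ℕ) :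
    (tensorPower ρ n).PosSemidef := by
  have h : tensorPower ρ n = _ :=
    congrArg (fun A => tensorPower A n) (eq_mul_diagonal_mul hρ.1)
  rw [h, tensorPower_mul, tensorPower_mul, tensorPower_conjTranspose, tensorPower_diagonal]
  refine Matrix.PosSemidef.mul_mul_conjTranspose_same (Matrix.PosSemidef.diagonal fun x => ?_) _
  exact Finset.prod_nonneg fun i _ => Complex.zero_le_real.2 (hρ.eigenvalues_nonneg _)

theorem IsUniversalBasis.sum_rotatedWeight {U : Matrix (Fin n → Fin d) (Fin n → Fin d) ℂ}
    {l : (Fin n → Fin d) → ℝ} (hU : IsUniversalBasis U l) {ρ : Matrix (Fin d) (Fin d) ℂ}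
    (hρ : IsDensity ρ) : ∑ x, rotatedWeight U (tensorPower ρ n) x = 1 := by
  have h := hU.sum_rotatedWeight_eq hρ (fun _ => True) (fun _ _ _ => Iff.rfl)
  simp only [if_true] at h
  rw [h, sum_pi_prod fun _ a => (ρ a a).re]
  simp [hρ.sum_diag_re]

end Assignment

/-! ### The extraction rate -/

section Rate

variable {d : ℕ} {E : Fin d → ℝ}

/-- A sequence of operations realising the work assignment of universal bases up to a vanishing
error extracts work at the rate given by the relative entropy. -/
theorem hasWorkRate_of_workAssignment [NeZero d] {β : ℝ} (hβ : 0 < β) (g : workSet E)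
    (hg : d = 1 ∨ 0 < (g : ℝ))
    {U : ∀ n : ℕ, Matrix (Fin n → Fin d) (Fin n → Fin d) ℂ} {l : ∀ n : ℕ, (Fin n → Fin d) → ℝ}
    (hU : ∀ n, IsUniversalBasis (U n) (l n))
    {Λ : ∀ n : ℕ, Matrix ((Fin n → Fin d) × workSet E) ((Fin n → Fin d) × workSet E) ℂ →
      Matrix (workSet E) (workSet E) ℂ} {ρ : Matrix (Fin d) (Fin d) ℂ} (hρ : IsDensity ρ)
    (hΛ₁ : ∀ n : ℕ, 0 < n → ∀ W : workSet E, (1 - 1 / ((n : ℝ) + 1)) *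
      (∑ x, open Classical in if workAssignment β g (l n) x = W then
        rotatedWeight (U n) (tensorPower ρ n) x else 0) ≤
      fidelityBasis (Λ n (tensorPower ρ n ⊗ₖ basisProj (workGround E))) W)
    (hΛ₂ : ∀ n : ℕ, 0 < n → ∀ W : workSet E, W ≠ workGround E →
      fidelityBasis (Λ n (tensorPower ρ n ⊗ₖ basisProj (workGround E))) W ≤
        ∑ x, open Classical in if workAssignment β g (l n) x = W then
          rotatedWeight (U n) (tensorPower ρ n) x else 0) :
    HasWorkRate E Λ ρ (relEntropy ρ (gibbs β E) / β) := by
  classical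
  set D := relEntropy ρ (gibbs β E) with hD
  have hD0 : 0 ≤ D := relEntropy_gibbs_nonneg β E hρ
  obtain ⟨C, hC⟩ := exists_concentration_const hβ E hρ
  -- Chosen so that the deviation (2 + β)δ at δ = c · width is a quarter of the cell width.
  set c : ℝ := 1 / (4 * (2 + β)) with hc
  have hc0 : 0 < c := by positivity
  have hcβ : (2 + β) * c = 1 / 4 := by rw [hc]; field_simp
  set typ : ∀ n : ℕ, (Fin n → Fin d) → Prop := fun n x =>
    0 < l n x ∧ |workScore β E (l n) x - n * D| < n * (gridWidth n / 4) with htyp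
  set bad : ℕ → ℝ := fun n =>
    ∑ x, if typ n x then 0 else rotatedWeight (U n) (tensorPower ρ n) x with hbad
  have hP0 : ∀ n x, 0 ≤ rotatedWeight (U n) (tensorPower ρ n) x := fun n x =>
    rotatedWeight_nonneg (posSemidef_tensorPower hρ.1 n) _ x
  have hbad0 : ∀ n, 0 ≤ bad n := fun n => Finset.sum_nonneg fun x _ => by
    split_ifs
    · exact le_rfl
    · exact hP0 n x
  have hbadlim : Tendsto bad atTop (𝓝 0) := by
    refine squeeze_zero' (Eventually.of_forall hbad0) ?_ (tendsto_deviation_bound C hc0 (d * d))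
    filter_upwards [eventually_gt_atTop 0] with n hn
    have h := hC n (U n) (l n) hn (hU n) (c * gridWidth n) (mul_pos hc0 (gridWidth_pos n))
    rw [← mul_assoc (2 + β), hcβ] at h
    have h1 : (1 / 4 : ℝ) * gridWidth n = gridWidth n / 4 := by ring
    rw [h1] at h
    exact h
  have htypscore : ∀ n x, 0 < n → typ n x →
      |workScore β E (l n) x / n - D| < gridWidth n / 4 := by
    intro n x hn h
    have hn' : (0 : ℝ) < n := by exact_mod_cast hn
    have h1 : workScore β E (l n) x / n - D = (workScore β E (l n) x - n * D) / n := by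
      field_simp
    rw [h1, abs_div, abs_of_pos hn', div_lt_iff₀ hn']
    linarith [h.2]
  suffices hsuff : ∀ ε : ℝ, 0 < ε → ε < 1 →
      limsup (fun n : ℕ => extractedWork E n (Λ n) ρ ε / (n : EReal)) atTop =
        ((D / β : ℝ) : EReal) by
    refine tendsto_const_nhds.congr' ?_
    filter_upwards [Ioo_mem_nhdsGT (zero_lt_one (α := ℝ))] with ε hε
    exact (hsuff ε hε.1 hε.2).symm
  intro ε hε hε1
  have hposE : ∀ {n : ℕ}, 0 < n → (0 : EReal) < (n : EReal) := fun hn => by exact_mod_cast hn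
  have htopE : ∀ n : ℕ, (n : EReal) ≠ ⊤ := fun n => EReal.natCast_ne_top n
  apply le_antisymm
  · rw [← EReal.le_of_forall_lt_iff_le]
    intro z hz
    have hz' : D / β < z := by exact_mod_cast hz
    refine limsup_le_of_le (by isBoundedDefault) ?_
    have h1 : ∀ᶠ n in atTop, bad n < 1 - ε := hbadlim.eventually_lt_const (by linarith)
    have h2 : ∀ᶠ n in atTop, gridWidth n < β * z - D :=
      tendsto_gridWidth.eventually_lt_const (by
        rw [div_lt_iff₀ hβ] at hz'
        linarith)
    filter_upwards [h1, h2, eventually_gt_atTop 0] with n hn1 hn2 hn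
    have hn' : (0 : ℝ) < n := by exact_mod_cast hn
    rw [EReal.div_le_iff_le_mul (hposE hn) (htopE n)]
    refine sSup_le ?_
    rintro _ ⟨W, rfl, hW⟩
    suffices h : (W : ℝ) ≤ n * z by
      have h' : ((W : ℝ) : EReal) ≤ ((n * z : ℝ) : EReal) := by exact_mod_cast h
      simpa using h'
    have hz0 : 0 ≤ z := (div_nonneg hD0 hβ.le).trans hz'.le
    by_cases hW0 : W = workGround E
    · rw [hW0]
      exact mul_nonneg hn'.le hz0
    -- If no typical x were sent to W, the fidelity would be at most the atypical weight, which is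
    -- already below 1 - ε.
    · have hex : ∃ x, workAssignment β g (l n) x = W ∧ typ n x := by
        by_contra hne
        push Not at hne
        have h3 : (∑ x, if workAssignment β g (l n) x = W then
            rotatedWeight (U n) (tensorPower ρ n) x else 0) ≤ bad n := by
          refine Finset.sum_le_sum fun x _ => ?_
          split_ifs with h4 h5 h5
          · exact absurd h5 (hne x h4)
          · exact le_rfl
          · exact le_rfl
          · exact hP0 n x
        linarith [hΛ₂ n hn W hW0]
      obtain ⟨x, hx, hxt⟩ := hex
      have h4 := (le_workScore_of_workAssignment hβ hn (g := g) (l := l n) (x := x)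
        (hx.symm ▸ hW0)).2
      rw [hx] at h4
      have h5 : 0 ≤ Real.log (2 * ((n : ℝ) + 1) ^ (d * d)) := by
        refine Real.log_nonneg ?_
        have : (1 : ℝ) ≤ ((n : ℝ) + 1) ^ (d * d) := one_le_pow₀ (by linarith)
        linarith
      have h6 := (abs_lt.1 hxt.2).2
      have h7 := gridWidth_pos n
      have h8 : β * (W : ℝ) ≤ β * (n * z) := by
        have h9 : n * (D + gridWidth n / 4) ≤ n * (β * z) :=
          mul_le_mul_of_nonneg_left (by linarith) hn'.le
        linarith
      exact le_of_mul_le_mul_left h8 hβ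
  · rw [← EReal.ge_of_forall_gt_iff_ge]
    intro z hz
    have hz' : z < D / β := by exact_mod_cast hz
    apply le_limsup_of_frequently_le'
    have hη : Tendsto (fun n : ℕ => (1 - 1 / ((n : ℝ) + 1)) * (1 - bad n)) atTop (𝓝 1) := by
      have h1 : Tendsto (fun n : ℕ => 1 - 1 / ((n : ℝ) + 1)) atTop (𝓝 (1 - 0)) :=
        tendsto_const_nhds.sub tendsto_one_div_add_atTop_nhds_zero_nat
      have h2 : Tendsto (fun n : ℕ => 1 - bad n) atTop (𝓝 (1 - 0)) :=
        tendsto_const_nhds.sub hbadlim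
      simpa using h1.mul h2
    have hrate : Tendsto (fun n : ℕ => D - gridWidth n -
        Real.log (2 * ((n : ℝ) + 1) ^ (d * d)) / n - β * g / n) atTop (𝓝 D) := by
      have h1 : Tendsto (fun n : ℕ => β * (g : ℝ) / (n : ℝ)) atTop (𝓝 0) :=
        tendsto_const_nhds.div_atTop tendsto_natCast_atTop_atTop
      simpa using ((tendsto_const_nhds.sub tendsto_gridWidth).sub
        (tendsto_log_div_natCast (d * d))).sub h1
    have hev : ∀ᶠ n : ℕ in atTop, 1 - ε < (1 - 1 / ((n : ℝ) + 1)) * (1 - bad n) ∧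
        β * z < D - gridWidth n - Real.log (2 * ((n : ℝ) + 1) ^ (d * d)) / n - β * g / n ∧
        0 < n :=
      (hη.eventually_const_lt (by linarith)).and ((hrate.eventually_const_lt (by
        rw [lt_div_iff₀ hβ] at hz'
        linarith)).and (eventually_gt_atTop 0))
    obtain ⟨N₀, hN₀⟩ := eventually_atTop.1 hev
    rw [frequently_atTop]
    intro N
    -- Only these n, with D well inside its cell, are controlled: all typical x then fall into the
    -- cell of D and receive the same level W.
    obtain ⟨n, hnk, m, hm1, hm2⟩ := exists_away_from_boundary D (max N N₀)
    have hnN : N ≤ n := by have := le_max_left N N₀; omega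
    have hnN₀ : N₀ ≤ n := by have := le_max_right N N₀; omega
    obtain ⟨hn1, hn2, hn⟩ := hN₀ n hnN₀
    have hn' : (0 : ℝ) < n := by exact_mod_cast hn
    refine ⟨n, hnN, ?_⟩
    set W := workMultiple g (workQuanta β g n D) with hW
    have hassign : ∀ x, typ n x → workAssignment β g (l n) x = W := by
      intro x hx
      rw [workAssignment, if_pos hx.1, hW, workQuanta, workQuanta,
        gridFloor_eq_of_near hm1 hm2 (htypscore n x hn hx)]
    have hprob : 1 - bad n ≤ ∑ x, if workAssignment β g (l n) x = W then
        rotatedWeight (U n) (tensorPower ρ n) x else 0 := by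
      rw [← (hU n).sum_rotatedWeight hρ, hbad, ← Finset.sum_sub_distrib]
      refine Finset.sum_le_sum fun x _ => ?_
      by_cases hx : typ n x
      · rw [if_pos hx, if_pos (hassign x hx), sub_zero]
      · rw [if_neg hx, sub_self]
        split_ifs
        · exact hP0 n x
        · exact le_rfl
    have hη0 : (0 : ℝ) ≤ 1 - 1 / ((n : ℝ) + 1) := by
      rw [sub_nonneg, div_le_one (by positivity)]
      linarith
    have hfid : 1 - ε ≤ fidelityBasis (Λ n (tensorPower ρ n ⊗ₖ basisProj (workGround E))) W :=
      hn1.le.trans ((mul_le_mul_of_nonneg_left hprob hη0).trans (hΛ₁ n hn W))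
    -- The loss in βW against nD is at most n times the cell width, the logarithm of the polynomial
    -- factor, and one quantum βg; all are o(n).
    have hWz : z * n ≤ (W : ℝ) := by
      rcases hg with h1 | hg0
      · subst h1
        have h2 : D = 0 := relEntropy_gibbs_of_dim_one β E hρ
        rw [h2, zero_div] at hz'
        exact (mul_nonpos_of_nonpos_of_nonneg hz'.le hn'.le).trans W.2.1
      · have h1 : (W : ℝ) = workQuanta β g n D * g := rfl
        have h2 := Nat.lt_floor_add_one ((n * gridFloor n D -
          Real.log (2 * ((n : ℝ) + 1) ^ (d * d))) / (β * g))
        rw [div_lt_iff₀ (by positivity)] at h2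
        have h3 := mul_lt_mul_of_pos_left (lt_gridFloor_add n D) hn'
        have h4 := mul_lt_mul_of_pos_left hn2 hn'
        have h5 : (n : ℝ) * (D - gridWidth n - Real.log (2 * ((n : ℝ) + 1) ^ (d * d)) / n -
            β * g / n) = n * (D - gridWidth n) - Real.log (2 * ((n : ℝ) + 1) ^ (d * d)) -
              β * g := by
          field_simp
        rw [h5] at h4
        have h6 : β * (z * n) ≤ β * (W : ℝ) := by
          rw [h1, workQuanta]
          linarith
        exact le_of_mul_le_mul_left h6 hβ
    rw [EReal.le_div_iff_mul_le (hposE hn) (htopE n)]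
    have h7 : (z : EReal) * (n : EReal) ≤ ((W : ℝ) : EReal) := by
      have h' : ((z * n : ℝ) : EReal) ≤ ((W : ℝ) : EReal) := by exact_mod_cast hWz
      simpa using h'
    exact h7.trans (le_sSup ⟨W, rfl, hfid⟩)

end Rate

end Thermo

theorem theorem1 {d : ℕ} (β : ℝ) (hβ : 0 < β) (E : Fin d → ℝ)
    (hE : d = 1 ∨ ∃ i j, E i ≠ E j) :
    ∃ R : Matrix (Fin d) (Fin d) ℂ → ℝ,
      Thermo.IsAchievableAgnosticRate β E {ρ | Thermo.IsDensity ρ} R ∧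
      ∀ ρ, Thermo.IsDensity ρ → β * R ρ = Thermo.relEntropy ρ (Thermo.gibbs β E) := by
  classical
  have hd : NeZero d := by
    rcases hE with h | ⟨i, -⟩
    · exact ⟨by omega⟩
    · exact ⟨fun h => by subst h; exact i.elim0⟩
  obtain ⟨g, hg⟩ := Thermo.exists_workSet_quantum E hE
  choose U l hU using Thermo.exists_isUniversalBasis d
  have hUE : ∀ n x y, U n x y ≠ 0 → Thermo.copiesEnergy E n x = Thermo.copiesEnergy E n y := by
    intro n x y h
    rw [Thermo.copiesEnergy_eq_sum_typeCount, Thermo.copiesEnergy_eq_sum_typeCount,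
      (hU n).block x y h]
  have hΛ := fun n : ℕ => Thermo.exists_thermalOperation_of_weights β E (hU n).unitary (hUE n)
    -- At n = 0 the score per copy makes no sense, so the storage is left alone; a limsup ignores
    -- this term.
    (fun x => if 0 < n then Thermo.workAssignment β g (l n) x else Thermo.workGround E)
    (by
      intro W hW
      rcases Nat.eq_zero_or_pos n with hn | hn
      · simp only [hn, lt_irrefl, if_false, Ne.symm hW, Finset.sum_const_zero, mul_zero]
        positivity
      · simp only [hn, if_true]
        exact Thermo.sum_exp_workAssignment_le hβ hn g (hU n) W hW)
    (η := 1 / ((n : ℝ) + 1)) (by positivity)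
  choose Λ hΛt hΛb using hΛ
  refine ⟨fun ρ => Thermo.relEntropy ρ (Thermo.gibbs β E) / β, ⟨Λ, hΛt, fun ρ hρ => ?_⟩,
    fun ρ _ => mul_div_cancel₀ _ hβ.ne'⟩
  refine Thermo.hasWorkRate_of_workAssignment hβ g hg hU hρ (fun n hn W => ?_)
    (fun n hn W hW => ?_)
  · have := (hΛb n _ (Thermo.posSemidef_tensorPower hρ.1 n) W).1
    simpa only [hn, if_true] using this
  · have := (hΛb n _ (Thermo.posSemidef_tensorPower hρ.1 n) W).2 hW
    simpa only [hn, if_true] using this
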